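/- Let $\mathbb{H}$ be a real separable Hilbert space and let $\boldsymbol{\xi}$ be a Gaussian random element in $\mathbb{H}$ with zero mean and covariance operator $\Sigma$. Let $\lambda_1\ge\lambda_2\ge\cdots\ge 0$ be the eigenvalues of $\Sigma$ in non-increasing order, counted with multiplicity (and continued by zeros if $\mathbb{H}$ is finite-dimensional). For $k=1,2$ put $\Lambda_k=\bigl(\sum_{j\ge k}\lambda_j^2\bigr)^{1/2}$, and define $$ \varkappa(\Sigma)=\begin{cases} \Lambda_1^{-1}, & \text{if } 3\lambda_1^2\le\Lambda_1^2,\\ (\lambda_1\Lambda_2)^{-1/2}, & \text{if } 3\lambda_1^2>\Lambda_1^2 \text{ and } 3\lambda_2^2\le\Lambda_2^2,\\ (\lambda_1\lambda_2)^{-1/2}, & \text{if } 3\lambda_1^2>\Lambda_1^2 \text{ and } 3\lambda_2^2>\Lambda_2^2, \end{cases} $$ with the convention $1/0=+\infty$ (so the bounds below are trivial if $\Sigma$ has rank at most one). Then there is an absolute constant $C<\infty$, independent of $\mathbb{H}$, of the distribution of $\boldsymbol{\xi}$, of $\boldsymbol{a}$ and of $\varepsilon$, such that for every $\boldsymbol{a}\in\mathbb{H}$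 and every $\varepsilon>0$ $$ \sup_{x>0}\mathbb{P}\bigl(x<\|\boldsymbol{\xi}-\boldsymbol{a}\|^2<x+\varepsilon\bigr)\le C\,\varkappa(\Sigma)\,\varepsilon . $$ Moreover, $\varkappa(\Sigma)$ can be replaced by $(\Lambda_1\Lambda_2)^{-1/2}$, that is, also $$ \sup_{x>0}\mathbb{P}\bigl(x<\|\boldsymbol{\xi}-\boldsymbol{a}\|^2<x+\varepsilon\bigr)\le C\,(\Lambda_1\Lambda_2)^{-1/2}\,\varepsilon . $$ -/

import Mathlib

open MeasureTheory ProbabilityTheory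
open scoped ENNReal NNReal

/-- The `k`-th largest eigenvalue (`k = 1, 2, …`), counted with multiplicity, of a positive
compact operator `T` on a real Hilbert space: the largest `t` for which there are `k` orthonormal
eigenvectors of `T` whose eigenvalues are all at least `t`. If the space has dimension smaller
than `k`, there are no such eigenvectors and the value is `sSup ∅ = 0`, that is, the list of
eigenvalues is continued by zeros. -/
noncomputable def orderedEigenvalue {H : Type*} [NormedAddCommGroup H] [InnerProductSpace ℝ H]
    (T : H →L[ℝ] H) (k : ℕ) : ℝ :=
  sSup {t : ℝ | ∃ v : Fin k → H, Orthonormal ℝ v ∧ ∀ i, ∃ μ : ℝ, t ≤ μ ∧ T (v i) = μ • v i}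

/-- `Λ_k(T) = (∑_{j ≥ k} λ_j(T)²)^{1/2}`, for `k = 1, 2, …`, where `λ_1(T) ≥ λ_2(T) ≥ …` are the
ordered eigenvalues of `T`. -/
noncomputable def eigenvalueTail {H : Type*} [NormedAddCommGroup H] [InnerProductSpace ℝ H]
    (T : H →L[ℝ] H) (k : ℕ) : ℝ≥0∞ :=
  (∑' j : ℕ, ENNReal.ofReal (orderedEigenvalue T (k + j)) ^ 2) ^ (1 / 2 : ℝ)

/-- The quantity `ϰ(T)`. It takes values in `[0, ∞]`, with `1 / 0 = ∞`, so that `ϰ(T) = ∞` when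
the rank of `T` is at most one. -/
noncomputable def varkappa {H : Type*} [NormedAddCommGroup H] [InnerProductSpace ℝ H]
    (T : H →L[ℝ] H) : ℝ≥0∞ :=
  if 3 * ENNReal.ofReal (orderedEigenvalue T 1) ^ 2 ≤ eigenvalueTail T 1 ^ 2 then
    (eigenvalueTail T 1)⁻¹
  else if 3 * ENNReal.ofReal (orderedEigenvalue T 2) ^ 2 ≤ eigenvalueTail T 2 ^ 2 then
    (ENNReal.ofReal (orderedEigenvalue T 1) * eigenvalueTail T 2) ^ (-(1 / 2) : ℝ)
  else
    (ENNReal.ofReal (orderedEigenvalue T 1) *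
      ENNReal.ofReal (orderedEigenvalue T 2)) ^ (-(1 / 2) : ℝ)

/-! Along orthonormal eigenvectors of the covariance operator the coordinates of `ξ` are independent
centred Gaussians, independent also of the remaining component. A coordinate of variance `μ`
contributes to the characteristic function of `‖ξ - a‖ ^ 2` a factor of modulus at most `(1 + 4 t²
μ²)^(-1/4)`, whatever `a` is, and the remaining component a factor of modulus at most 1
(`norm_integral_cexp_norm_sq_le`). By `measure_lt_lt_add_le` an integrable majorant of the
characteristic function bounds the probability of an interval by its integral times `ε`.

If no `μ_i²` dominates the sum of squares, the third elementary symmetric sum makes the product of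
the `1 + 4 t² μ_i²` grow like `t^6` (`one_add_cube_le_prod`), so the decay is `|t|^(-3/2)`. If only
the first dominates, its factor is bounded by `|μ₁ t|^(-1/2)`, integrable at 0, and the others are
treated as before. If the second dominates the rest too, two factors decay only like `1/|t|`;
instead, the plane Gaussian density is bounded and an annulus between squared radii `r` and `r + ε`
has area `π ε`, uniformly in `r`.

The suprema defining the ordered eigenvalues are not shown to be attained. Finitely many
eigenvectors, with eigenvalues within a factor `q < 1` of them and carrying most of the tail sum,
suffice; the slack between `1/3` and `2/5` absorbs this loss. The second bound follows from
`varkappa_le`. -/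

/-! ### Ordered eigenvalues and almost optimal eigenvectors. -/

section Eigenvalues

variable {H : Type*} [NormedAddCommGroup H] [InnerProductSpace ℝ H]

open scoped InnerProductSpace

/-- By dimension count some `u i` lies outside the span of `w`. Projecting it off that span keeps it
an eigenvector with the same eigenvalue. -/
lemma exists_unit_eigenvector_orthogonal {T : H →L[ℝ] H}
    (hT : ∀ x y, ⟪T x, y⟫_ℝ = ⟪x, T y⟫_ℝ) {k : ℕ} {w : Fin k → H} (hw : Orthonormal ℝ w)
    {μ : Fin k → ℝ} (hμ : ∀ j, T (w j) = μ j • w j) {u : Fin (k + 1) → H} (hu : Orthonormal ℝ u)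
    {ν : Fin (k + 1) → ℝ} (hν : ∀ i, T (u i) = ν i • u i) :
    ∃ i, ∃ x : H, ‖x‖ = 1 ∧ (∀ j, ⟪w j, x⟫_ℝ = 0) ∧ T x = ν i • x := by
  classical
  set y : Fin (k + 1) → H := fun i ↦ u i - ∑ j, ⟪w j, u i⟫_ℝ • w j with hy
  have hne : ∃ i, y i ≠ 0 := by
    by_contra! h
    have hmem : ∀ i, u i ∈ Submodule.span ℝ (Set.range w) := fun i ↦ by
      rw [sub_eq_zero.1 (h i)]
      exact Submodule.sum_mem _ fun j _ ↦
        Submodule.smul_mem _ _ (Submodule.subset_span (Set.mem_range_self j))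
    have hle : Submodule.span ℝ (Set.range u) ≤ Submodule.span ℝ (Set.range w) :=
      Submodule.span_le.2 (by rintro _ ⟨i, rfl⟩; exact hmem i)
    have : FiniteDimensional ℝ (Submodule.span ℝ (Set.range w)) :=
      FiniteDimensional.span_of_finite ℝ (Set.finite_range w)
    have h1 := Submodule.finrank_mono hle
    rw [finrank_span_eq_card hu.linearIndependent, finrank_span_eq_card hw.linearIndependent] at h1
    simp at h1
  obtain ⟨i, hi⟩ := hne
  have horth : ∀ j, ⟪w j, y i⟫_ℝ = 0 := fun j ↦ by
    simp only [hy, inner_sub_right, inner_sum, inner_smul_right]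
    rw [Finset.sum_eq_single j]
    · simp [hw.1 j]
    · intro l _ hl
      rw [hw.2 hl.symm, mul_zero]
    · simp
  have heig : T (y i) = ν i • y i := by
    simp only [hy, map_sub, map_sum, map_smul, hμ, hν, smul_sub, Finset.smul_sum]
    congr 1
    refine Finset.sum_congr rfl fun j _ ↦ ?_
    -- Symmetry gives `(μ j - ν i) ⟪w j, u i⟫ = 0`: only the `w j` with eigenvalue `ν i` enter the
    -- projection.
    have h2 := hT (w j) (u i)
    rw [hμ, hν, inner_smul_left, inner_smul_right] at h2
    simp only [conj_trivial] at h2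
    rw [smul_smul, smul_smul, mul_comm, h2]
  refine ⟨i, ‖y i‖⁻¹ • y i, ?_, fun j ↦ ?_, ?_⟩
  · rw [norm_smul, norm_inv, norm_norm, inv_mul_cancel₀ (norm_ne_zero_iff.2 hi)]
  · rw [inner_smul_right, horth, mul_zero]
  · rw [map_smul, heig, smul_comm]

/-- The families given for different `k` are unrelated; a single one is built greedily, each new
vector being taken orthogonal to the previous ones. The resulting `μ` need not be sorted. -/
lemma exists_orthonormal_eigenvectors_ge {T : H →L[ℝ] H}
    (hT : ∀ x y, ⟪T x, y⟫_ℝ = ⟪x, T y⟫_ℝ) {t : ℕ → ℝ} {n : ℕ}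
    (h : ∀ k < n, ∃ v : Fin (k + 1) → H, Orthonormal ℝ v ∧
      ∀ i, ∃ μ : ℝ, t k ≤ μ ∧ T (v i) = μ • v i) :
    ∃ (v : Fin n → H) (μ : Fin n → ℝ), Orthonormal ℝ v ∧ (∀ i : Fin n, t i ≤ μ i) ∧
      ∀ i, T (v i) = μ i • v i := by
  induction n with
  | zero => exact ⟨Fin.elim0, Fin.elim0, ⟨fun i ↦ i.elim0, fun i ↦ i.elim0⟩, fun i ↦ i.elim0,
      fun i ↦ i.elim0⟩
  | succ n ih =>
    obtain ⟨w, μ, hw, hle, hμ⟩ := ih fun k hk ↦ h k (hk.trans n.lt_succ_self)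
    obtain ⟨u, hu, hu'⟩ := h n n.lt_succ_self
    choose ν hν1 hν2 using hu'
    obtain ⟨i, x, hx, hxw, hxT⟩ := exists_unit_eigenvector_orthogonal hT hw hμ hu hν2
    refine ⟨Fin.snoc w x, Fin.snoc μ (ν i), ⟨fun j ↦ ?_, fun j l hjl ↦ ?_⟩, fun j ↦ ?_,
      fun j ↦ ?_⟩
    · refine Fin.lastCases ?_ (fun j ↦ ?_) j
      · simpa using hx
      · simpa using hw.1 j
    · revert hjl
      refine Fin.lastCases ?_ (fun j ↦ ?_) j <;> refine Fin.lastCases ?_ (fun l ↦ ?_) l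
      · simp
      · intro _
        simpa [real_inner_comm] using hxw l
      · intro _
        simpa using hxw j
      · intro hjl
        simpa using hw.2 (fun h ↦ hjl (by rw [h]))
    · refine Fin.lastCases ?_ (fun j ↦ ?_) j
      · simpa using hν1 i
      · simpa using hle j
    · refine Fin.lastCases ?_ (fun j ↦ ?_) j
      · simpa using hxT
      · simpa using hμ j

/-- The norm of `T` bounds the set. For `k = 0` the condition on `t` is vacuous and `sSup` takes its
default value 0. -/
lemma le_orderedEigenvalue {T : H →L[ℝ] H} {k : ℕ} (hk : k ≠ 0) {t : ℝ} {v : Fin k → H}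
    (hv : Orthonormal ℝ v) (h : ∀ i, ∃ μ : ℝ, t ≤ μ ∧ T (v i) = μ • v i) :
    t ≤ orderedEigenvalue T k := by
  refine le_csSup ⟨‖T‖, ?_⟩ ⟨v, hv, h⟩
  rintro s ⟨u, hu, hs⟩
  obtain ⟨μ, hμ, he⟩ := hs ⟨0, Nat.pos_of_ne_zero hk⟩
  have h1 := T.le_opNorm (u ⟨0, Nat.pos_of_ne_zero hk⟩)
  rw [he, norm_smul, hu.1, mul_one, mul_one] at h1
  exact hμ.trans ((le_abs_self μ).trans h1)

lemma exists_orthonormal_of_lt_orderedEigenvalue {T : H →L[ℝ] H} {k : ℕ} {t : ℝ}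
    (h0 : 0 < orderedEigenvalue T k) (ht : t < orderedEigenvalue T k) :
    ∃ v : Fin k → H, Orthonormal ℝ v ∧ ∀ i, ∃ μ : ℝ, t ≤ μ ∧ T (v i) = μ • v i := by
  have hne : {t : ℝ | ∃ v : Fin k → H, Orthonormal ℝ v ∧
      ∀ i, ∃ μ : ℝ, t ≤ μ ∧ T (v i) = μ • v i}.Nonempty := by
    by_contra h
    rw [Set.not_nonempty_iff_eq_empty] at h
    simp [orderedEigenvalue, h] at h0
  obtain ⟨s, ⟨v, hv, hs⟩, hts⟩ := exists_lt_of_lt_csSup hne ht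
  refine ⟨v, hv, fun i ↦ ?_⟩
  obtain ⟨μ, h1, h2⟩ := hs i
  exact ⟨μ, hts.le.trans h1, h2⟩

/-- Positivity excludes the default `sSup ∅ = 0`, which could exceed a negative eigenvalue. -/
lemma orderedEigenvalue_le_of_le {T : H →L[ℝ] H} {k m : ℕ} (hk : k ≠ 0) (hkm : k ≤ m)
    (h0 : 0 < orderedEigenvalue T m) : orderedEigenvalue T m ≤ orderedEigenvalue T k := by
  refine le_of_forall_lt_imp_le_of_dense fun t ht ↦ ?_
  obtain ⟨v, hv, h⟩ := exists_orthonormal_of_lt_orderedEigenvalue h0 ht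
  exact le_orderedEigenvalue hk (hv.comp (Fin.castLE hkm) (Fin.castLE_injective hkm))
    fun i ↦ h (Fin.castLE hkm i)

/-- Eigenvectors whose eigenvalues are nearly as large as the ordered eigenvalues. -/
lemma exists_orthonormal_eigenvectors_near {T : H →L[ℝ] H}
    (hT : ∀ x y, ⟪T x, y⟫_ℝ = ⟪x, T y⟫_ℝ) {n : ℕ} (hn : ∀ k < n, 0 < orderedEigenvalue T (k + 1))
    {q : ℝ} (hq : q < 1) :
    ∃ (v : Fin n → H) (μ : Fin n → ℝ), Orthonormal ℝ v ∧
      (∀ i : Fin n, q * orderedEigenvalue T (i + 1) ≤ μ i) ∧ ∀ i, T (v i) = μ i • v i :=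
  exists_orthonormal_eigenvectors_ge (t := fun k ↦ q * orderedEigenvalue T (k + 1)) hT fun k hk ↦
    exists_orthonormal_of_lt_orderedEigenvalue (hn k hk) (by nlinarith [hn k hk])

lemma eigenvalue_le_orderedEigenvalue_one {T : H →L[ℝ] H} {n : ℕ} {v : Fin n → H}
    (hv : Orthonormal ℝ v) {μ : Fin n → ℝ} (hμ : ∀ i, T (v i) = μ i • v i) (i : Fin n) :
    μ i ≤ orderedEigenvalue T 1 :=
  le_orderedEigenvalue one_ne_zero (hv.comp (fun _ : Fin 1 ↦ i)
    (Function.injective_of_subsingleton _)) fun _ ↦ ⟨μ i, le_rfl, hμ i⟩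

lemma min_eigenvalue_le_orderedEigenvalue_two {T : H →L[ℝ] H} {n : ℕ} {v : Fin n → H}
    (hv : Orthonormal ℝ v) {μ : Fin n → ℝ} (hμ : ∀ i, T (v i) = μ i • v i) {i j : Fin n}
    (hij : i ≠ j) : min (μ i) (μ j) ≤ orderedEigenvalue T 2 := by
  refine le_orderedEigenvalue two_ne_zero (hv.comp ![i, j] ?_) fun l ↦ ⟨μ (![i, j] l), ?_, hμ _⟩
  · intro a b
    fin_cases a <;> fin_cases b <;> simp [hij, hij.symm]
  · fin_cases l <;> simp

end Eigenvalues

/-! ### The characteristic function of a shifted Gaussian square. -/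

section CharFun

/-- Completing the square, with `b = -1/(2v) + t i`, leaves the factor `exp (i t a² + t² a² / b)`.
Since `b` has negative real part, so does `1 / b`, and the shift `a` can only decrease the modulus.
-/
lemma norm_integral_cexp_sq_gaussianReal_le (t a : ℝ) {v : ℝ≥0} (hv : v ≠ 0) :
    ‖∫ x, Complex.exp (t * (x - a) ^ 2 * Complex.I) ∂(gaussianReal 0 v)‖ ≤
      (1 + 4 * t ^ 2 * v ^ 2) ^ (-(1 / 4) : ℝ) := by
  have hv' : (0 : ℝ) < v := by positivity
  set b : ℂ := -(2 * v)⁻¹ + t * Complex.I with hb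
  have hbre : b.re = -(2 * (v : ℝ))⁻¹ := by
    have : b = ((-(2 * (v : ℝ))⁻¹ : ℝ) : ℂ) + (t : ℂ) * Complex.I := by rw [hb]; push_cast; rfl
    rw [this]
    simp
  have hbim : b.im = t := by
    have : b = ((-(2 * (v : ℝ))⁻¹ : ℝ) : ℂ) + (t : ℂ) * Complex.I := by rw [hb]; push_cast; rfl
    rw [this]
    simp
  have hbneg : b.re < 0 := by rw [hbre]; simpa using hv'
  set D : ℝ := 1 + 4 * t ^ 2 * v ^ 2 with hD
  have hDpos : 0 < D := by positivity
  have hnb : ‖b‖ = √D / (2 * v) := by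
    rw [Complex.norm_eq_sqrt_sq_add_sq, hbre, hbim, eq_div_iff (by positivity),
      ← Real.sqrt_sq (by positivity : 0 ≤ 2 * (v : ℝ)), ← Real.sqrt_mul (by positivity)]
    rw [Real.sqrt_sq (by positivity : 0 ≤ 2 * (v : ℝ))]
    congr 1
    rw [hD]
    field_simp
    ring
  have hint : ∫ x, Complex.exp (t * (x - a) ^ 2 * Complex.I) ∂(gaussianReal 0 v) =
      ((√(2 * Real.pi * v))⁻¹ : ℝ) * ((Real.pi / -b) ^ (1 / 2 : ℂ) *
        Complex.exp (t * a ^ 2 * Complex.I - (-(2 * t * a * Complex.I)) ^ 2 / (4 * b))) := by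
    rw [integral_gaussianReal_eq_integral_smul hv, ← integral_cexp_quadratic hbneg,
      ← integral_const_mul]
    refine integral_congr_ae (Filter.Eventually.of_forall fun x ↦ ?_)
    simp only [gaussianPDFReal, Complex.real_smul, Complex.ofReal_mul, Complex.ofReal_exp]
    rw [mul_assoc, ← Complex.exp_add]
    congr 2
    rw [hb]
    push_cast
    field_simp
    ring
  rw [hint, norm_mul, norm_mul, Complex.norm_real, Real.norm_of_nonneg (by positivity)]
  have h1 : ‖(Real.pi / -b) ^ (1 / 2 : ℂ)‖ = √(2 * Real.pi * v) * D ^ (-(1 / 4) : ℝ) := by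
    have : (1 / 2 : ℂ) = ((1 / 2 : ℝ) : ℂ) := by push_cast; rfl
    rw [this, Complex.norm_cpow_real, norm_div, norm_neg, Complex.norm_real,
      Real.norm_of_nonneg Real.pi_pos.le, hnb]
    rw [show Real.pi / (√D / (2 * v)) = (2 * Real.pi * v) * (√D)⁻¹ by field_simp,
      Real.mul_rpow (by positivity) (by positivity), ← Real.sqrt_eq_rpow, Real.sqrt_eq_rpow D,
      ← Real.rpow_neg hDpos.le, ← Real.rpow_mul hDpos.le]
    norm_num
  have h2 : ‖Complex.exp (t * a ^ 2 * Complex.I - (-(2 * t * a * Complex.I)) ^ 2 / (4 * b))‖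
      ≤ 1 := by
    rw [Complex.norm_exp, Real.exp_le_one_iff]
    have h3 : (t * a ^ 2 * Complex.I - (-(2 * t * a * Complex.I)) ^ 2 / (4 * b) : ℂ) =
        ((t * a ^ 2 : ℝ) : ℂ) * Complex.I + ((t ^ 2 * a ^ 2 : ℝ) : ℂ) * b⁻¹ := by
      have : b ≠ 0 := by
        intro h
        simp [h] at hbneg
      push_cast
      field_simp
      linear_combination (-4 * t ^ 2 * a ^ 2 : ℂ) * Complex.I_sq
    rw [h3, Complex.add_re, Complex.re_ofReal_mul, Complex.re_ofReal_mul, Complex.I_re,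
      Complex.inv_re, mul_zero, zero_add]
    exact mul_nonpos_of_nonneg_of_nonpos (by positivity)
      (div_nonpos_of_nonpos_of_nonneg hbneg.le (Complex.normSq_nonneg _))
  rw [h1]
  calc (√(2 * Real.pi * v))⁻¹ * (√(2 * Real.pi * v) * D ^ (-(1 / 4) : ℝ) * _)
      ≤ (√(2 * Real.pi * v))⁻¹ * (√(2 * Real.pi * v) * D ^ (-(1 / 4) : ℝ) * 1) := by gcongr
    _ = D ^ (-(1 / 4) : ℝ) := by
      rw [mul_one, inv_mul_cancel_left₀ (by positivity)]

end CharFun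

/-! ### Splitting off the span of an orthonormal family. -/

section Residual

open scoped InnerProductSpace

variable {H : Type*} [NormedAddCommGroup H] [InnerProductSpace ℝ H] {ι : Type*} [Fintype ι]

/-- The residual of the orthogonal projection on the span of an orthonormal family. -/
noncomputable def orthonormalResidual (v : ι → H) : H →L[ℝ] H :=
  ContinuousLinearMap.id ℝ H - ∑ i, (innerSL ℝ (v i)).smulRight (v i)

lemma orthonormalResidual_apply (v : ι → H) (x : H) :
    orthonormalResidual v x = x - ∑ i, ⟪v i, x⟫_ℝ • v i := by
  simp [orthonormalResidual]

lemma orthonormalResidual_self {v : ι → H} (hv : Orthonormal ℝ v) (i : ι) :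
    orthonormalResidual v (v i) = 0 := by
  classical
  rw [orthonormalResidual_apply, Finset.sum_eq_single i]
  · simp [hv.1 i]
  · intro j _ hj
    rw [hv.2 hj, zero_smul]
  · simp

lemma norm_sq_eq_sum_add_residual {v : ι → H} (hv : Orthonormal ℝ v) (x : H) :
    ‖x‖ ^ 2 = ∑ i, ⟪v i, x⟫_ℝ ^ 2 + ‖orthonormalResidual v x‖ ^ 2 := by
  have h1 : ⟪x, ∑ i, ⟪v i, x⟫_ℝ • v i⟫_ℝ = ∑ i, ⟪v i, x⟫_ℝ ^ 2 := by
    simp only [inner_sum, inner_smul_right, real_inner_comm, sq]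
  have h2 : ‖∑ i, ⟪v i, x⟫_ℝ • v i‖ ^ 2 = ∑ i, ⟪v i, x⟫_ℝ ^ 2 := by
    rw [← real_inner_self_eq_norm_sq, hv.inner_sum]
    simp [sq]
  rw [orthonormalResidual_apply, norm_sub_sq_real, h1, h2]
  ring

end Residual

/-! ### Independence of the eigencoordinates and the residual. -/

section Decomposition

open scoped InnerProductSpace

variable {Ω : Type*} [MeasurableSpace Ω] {P : Measure Ω}
  {H : Type*} [NormedAddCommGroup H] [InnerProductSpace ℝ H] [CompleteSpace H]
  [SecondCountableTopology H] [MeasurableSpace H] [BorelSpace H] {ξ : Ω → H}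
  {ι : Type*} [Fintype ι] {v : ι → H} {μ : ι → ℝ}

lemma integral_inner_eq_zero (hξ : HasGaussianLaw ξ P) (h0 : ∫ ω, ξ ω ∂P = 0) (x : H) :
    ∫ ω, ⟪x, ξ ω⟫_ℝ ∂P = 0 := by
  rw [integral_inner hξ.integrable, h0, inner_zero_right]

lemma covariance_inner_eq (hξ : HasGaussianLaw ξ P) (h0 : ∫ ω, ξ ω ∂P = 0) (x y : H) :
    cov[fun ω ↦ ⟪x, ξ ω⟫_ℝ, fun ω ↦ ⟪y, ξ ω⟫_ℝ; P] =
      ⟪covarianceOperator (P.map ξ) x, y⟫_ℝ := by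
  have := hξ.isGaussian_map
  rw [covarianceOperator_inner (IsGaussian.memLp_id _ 2 (by simp)),
    integral_map hξ.aemeasurable (by fun_prop)]
  simp [covariance, integral_inner_eq_zero hξ h0]

omit [SecondCountableTopology H] in
lemma covarianceOperator_symm (μ : Measure H) (x y : H) :
    ⟪covarianceOperator μ x, y⟫_ℝ = ⟪x, covarianceOperator μ y⟫_ℝ :=
  isPositive_covarianceOperator.isSymmetric x y

omit [Fintype ι] in
lemma map_inner_eq_gaussianReal (hξ : HasGaussianLaw ξ P) (h0 : ∫ ω, ξ ω ∂P = 0)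
    (hv : Orthonormal ℝ v) (hμ : ∀ i, covarianceOperator (P.map ξ) (v i) = μ i • v i) (i : ι) :
    P.map (fun ω ↦ ⟪v i, ξ ω⟫_ℝ) = gaussianReal 0 (μ i).toNNReal := by
  have h1 : HasGaussianLaw (fun ω ↦ ⟪v i, ξ ω⟫_ℝ) P := hξ.map_fun (innerSL ℝ (v i))
  rw [h1.map_eq_gaussianReal, integral_inner_eq_zero hξ h0, ← covariance_self h1.aemeasurable,
    covariance_inner_eq hξ h0, hμ, inner_smul_left, real_inner_self_eq_norm_sq, hv.1]
  simp

lemma iIndepFun_inner (hξ : HasGaussianLaw ξ P) (h0 : ∫ ω, ξ ω ∂P = 0)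
    (hv : Orthonormal ℝ v) (hμ : ∀ i, covarianceOperator (P.map ξ) (v i) = μ i • v i) :
    iIndepFun (fun i ω ↦ ⟪v i, ξ ω⟫_ℝ) P := by
  refine HasGaussianLaw.iIndepFun_of_covariance_eq_zero
    (hξ.map_fun (ContinuousLinearMap.pi fun i ↦ innerSL ℝ (v i))) fun i j hij ↦ ?_
  rw [covariance_inner_eq hξ h0, hμ, inner_smul_left, hv.2 hij, mul_zero]

lemma indepFun_inner_residual (hξ : HasGaussianLaw ξ P) (h0 : ∫ ω, ξ ω ∂P = 0)
    (hv : Orthonormal ℝ v) (hμ : ∀ i, covarianceOperator (P.map ξ) (v i) = μ i • v i) :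
    IndepFun (fun ω i ↦ ⟪v i, ξ ω⟫_ℝ) (fun ω ↦ orthonormalResidual v (ξ ω)) P := by
  classical
  refine HasGaussianLaw.indepFun_of_covariance_strongDual
    (hξ.map_fun ((ContinuousLinearMap.pi fun i ↦ innerSL ℝ (v i)).prod
      (orthonormalResidual v))) fun L₁ L₂ ↦ ?_
  -- For jointly Gaussian vectors uncorrelatedness suffices. The Riesz vector `w` of `L₂` after the
  -- residual is orthogonal to every `v i`, and the covariance operator only rescales `v i`.
  set w : H := (InnerProductSpace.toDual ℝ H).symm (L₂.comp (orthonormalResidual v)) with hw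
  have hL₁ : L₁ ∘ (fun ω i ↦ ⟪v i, ξ ω⟫_ℝ) =
      fun ω ↦ ⟪∑ i, L₁ (Pi.single i 1) • v i, ξ ω⟫_ℝ := by
    ext ω
    have := L₁.toLinearMap.pi_apply_eq_sum_univ (fun i ↦ ⟪v i, ξ ω⟫_ℝ)
    simp only [ContinuousLinearMap.coe_coe] at this
    simp only [Function.comp_apply, sum_inner, inner_smul_left, conj_trivial, this, smul_eq_mul]
    refine Finset.sum_congr rfl fun i _ ↦ ?_
    rw [mul_comm]
    congr 2
    ext j
    simp [Pi.single_apply, eq_comm]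
  have hL₂ : L₂ ∘ (fun ω ↦ orthonormalResidual v (ξ ω)) = fun ω ↦ ⟪w, ξ ω⟫_ℝ := by
    ext ω
    simp [hw]
  have hwv : ∀ i, ⟪v i, w⟫_ℝ = 0 := fun i ↦ by
    rw [real_inner_comm, hw, InnerProductSpace.toDual_symm_apply]
    simp [orthonormalResidual_self hv]
  rw [hL₁, hL₂, covariance_inner_eq hξ h0, map_sum, sum_inner]
  refine Finset.sum_eq_zero fun i _ ↦ ?_
  rw [map_smul, hμ, inner_smul_left, inner_smul_left, hwv, mul_zero, mul_zero]

lemma norm_integral_cexp_norm_sq_le (hξ : HasGaussianLaw ξ P) (h0 : ∫ ω, ξ ω ∂P = 0)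
    (hv : Orthonormal ℝ v) (hμ : ∀ i, covarianceOperator (P.map ξ) (v i) = μ i • v i)
    (hpos : ∀ i, 0 < μ i) (a : H) (t : ℝ) :
    ‖∫ ω, Complex.exp (t * (‖ξ ω - a‖ ^ 2 : ℝ) * Complex.I) ∂P‖ ≤
      ∏ i, (1 + 4 * t ^ 2 * μ i ^ 2) ^ (-(1 / 4) : ℝ) := by
  set f : (ι → ℝ) → ℂ := fun x ↦
    ∏ i, Complex.exp (t * (x i - ⟪v i, a⟫_ℝ : ℝ) ^ 2 * Complex.I) with hf
  set g : H → ℂ := fun r ↦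
    Complex.exp ((t * ‖r - orthonormalResidual v a‖ ^ 2 : ℝ) * Complex.I) with hg
  have haem := hξ.aemeasurable
  have := hξ.isProbabilityMeasure
  have h1 : ∀ ω, Complex.exp (t * (‖ξ ω - a‖ ^ 2 : ℝ) * Complex.I) =
      f (fun i ↦ ⟪v i, ξ ω⟫_ℝ) * g (orthonormalResidual v (ξ ω)) := fun ω ↦ by
    rw [norm_sq_eq_sum_add_residual hv, map_sub, hf, hg]
    simp only [← Complex.exp_sum, ← Complex.exp_add, inner_sub_right]
    congr 1
    push_cast
    rw [← Finset.sum_mul, ← Finset.mul_sum]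
    ring
  have hX : AEMeasurable (fun ω i ↦ ⟪v i, ξ ω⟫_ℝ) P := by fun_prop
  have hR : AEMeasurable (fun ω ↦ orthonormalResidual v (ξ ω)) P := by fun_prop
  have hfm : Measurable f := by fun_prop
  have hgm : Measurable g := by fun_prop
  simp_rw [h1]
  rw [(indepFun_inner_residual hξ h0 hv hμ).integral_fun_comp_mul_comp hX hR
    hfm.aestronglyMeasurable hgm.aestronglyMeasurable, norm_mul]
  have h2 : ‖∫ ω, g (orthonormalResidual v (ξ ω)) ∂P‖ ≤ 1 := by
    refine (norm_integral_le_of_norm_le_const (C := 1)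
      (Filter.Eventually.of_forall fun ω ↦ ?_)).trans (by simp)
    simp only [hg, Complex.norm_exp_ofReal_mul_I, le_refl]
  have h3 : ∫ ω, f (fun i ↦ ⟪v i, ξ ω⟫_ℝ) ∂P =
      ∏ i, ∫ x, Complex.exp (t * (x - ⟪v i, a⟫_ℝ) ^ 2 * Complex.I)
        ∂(gaussianReal 0 (μ i).toNNReal) := by
    rw [hf]
    have h4 := (iIndepFun_inner hξ h0 hv hμ).integral_fun_prod_comp
      (f := fun i x ↦ Complex.exp (t * (x - ⟪v i, a⟫_ℝ : ℝ) ^ 2 * Complex.I))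
      (fun i ↦ by fun_prop)
      (fun i ↦ (Measurable.aestronglyMeasurable (by fun_prop)))
    rw [h4]
    refine Finset.prod_congr rfl fun i _ ↦ ?_
    rw [← map_inner_eq_gaussianReal hξ h0 hv hμ i, integral_map (by fun_prop)
      (Measurable.aestronglyMeasurable (by fun_prop))]
    simp
  rw [h3, norm_prod]
  refine (mul_le_of_le_one_right (by positivity) h2).trans ?_
  refine Finset.prod_le_prod (fun i _ ↦ norm_nonneg _) fun i _ ↦ ?_
  have h5 := norm_integral_cexp_sq_gaussianReal_le t ⟪v i, a⟫_ℝ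
    (v := (μ i).toNNReal) (by simpa using hpos i)
  rwa [Real.coe_toNNReal _ (hpos i).le] at h5

/-- Bessel's inequality under the expectation. This is the trace bound that makes the tails finite.
-/
lemma sum_eigenvalues_le (hξ : HasGaussianLaw ξ P) (h0 : ∫ ω, ξ ω ∂P = 0)
    (hv : Orthonormal ℝ v) (hμ : ∀ i, covarianceOperator (P.map ξ) (v i) = μ i • v i) :
    ∑ i, μ i ≤ ∫ ω, ‖ξ ω‖ ^ 2 ∂P := by
  have := hξ.isProbabilityMeasure
  have h2 : MemLp ξ 2 P := hξ.memLp_two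
  have hX : ∀ i, MemLp (fun ω ↦ ⟪v i, ξ ω⟫_ℝ) 2 P := fun i ↦ h2.const_inner (v i)
  have h1 : ∀ i, μ i = ∫ ω, ⟪v i, ξ ω⟫_ℝ ^ 2 ∂P := fun i ↦ by
    have := covariance_inner_eq hξ h0 (v i) (v i)
    rw [hμ, inner_smul_left, real_inner_self_eq_norm_sq, hv.1] at this
    simp only [covariance, integral_inner_eq_zero hξ h0] at this
    simpa [sq] using this.symm
  simp_rw [h1]
  rw [← integral_finsetSum _ fun i _ ↦ (hX i).integrable_sq]
  refine integral_mono (integrable_finsetSum _ fun i _ ↦ (hX i).integrable_sq)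
    h2.integrable_norm_pow' fun ω ↦ ?_
  have := norm_sq_eq_sum_add_residual hv (ξ ω)
  simp only
  nlinarith [sq_nonneg ‖orthonormalResidual v (ξ ω)‖]

end Decomposition

/-! ### A bound for the Gaussian density. -/

section GaussianDensity

lemma gaussianReal_le_smul_volume {v : ℝ≥0} (hv : v ≠ 0) :
    gaussianReal 0 v ≤ ENNReal.ofReal (2 * √v)⁻¹ • volume := by
  have hv' : (0 : ℝ) < v := by positivity
  rw [gaussianReal_of_var_ne_zero _ hv, ← withDensity_const]
  refine withDensity_mono (Filter.Eventually.of_forall fun x ↦ ENNReal.ofReal_le_ofReal ?_)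
  rw [gaussianPDFReal]
  have h1 : Real.exp (-(x - 0) ^ 2 / (2 * v)) ≤ 1 := by
    rw [Real.exp_le_one_iff, neg_div]
    exact neg_nonpos.2 (by positivity)
  have h2 : 2 * √v ≤ √(2 * Real.pi * v) := by
    refine Real.le_sqrt_of_sq_le ?_
    rw [mul_pow, Real.sq_sqrt hv'.le]
    gcongr
    nlinarith [Real.pi_gt_three]
  calc (√(2 * Real.pi * v))⁻¹ * Real.exp (-(x - 0) ^ 2 / (2 * v))
      ≤ (2 * √v)⁻¹ * 1 := by gcongr
    _ = (2 * √v)⁻¹ := mul_one _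

end GaussianDensity

/-! ### The smoothing inequality. -/

section Smoothing

variable {Ω : Type*} [MeasurableSpace Ω] {P : Measure Ω} [IsProbabilityMeasure P]

/-- The Gaussian bump of width `ε` is the characteristic function of a Gaussian of variance `ε⁻¹ ^
2`; then Fubini. -/
lemma integral_exp_neg_sq_eq {Q : Ω → ℝ} (hQ : AEMeasurable Q P) (x ε : ℝ) :
    ((∫ ω, Real.exp (-(Q ω - x) ^ 2 * ε⁻¹ ^ 2 / 2) ∂P : ℝ) : ℂ) =
      ∫ s, Complex.exp (-(s * x : ℝ) * Complex.I) *
        (∫ ω, Complex.exp (s * Q ω * Complex.I) ∂P)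
          ∂(gaussianReal 0 (Real.toNNReal (ε⁻¹ ^ 2))) := by
  have h1 : ∀ ω, ((Real.exp (-(Q ω - x) ^ 2 * ε⁻¹ ^ 2 / 2) : ℝ) : ℂ) =
      ∫ s, Complex.exp ((s * (Q ω - x) : ℝ) * Complex.I)
        ∂(gaussianReal 0 (Real.toNNReal (ε⁻¹ ^ 2))) := fun ω ↦ by
    have h2 := charFun_gaussianReal (μ := 0) (v := Real.toNNReal (ε⁻¹ ^ 2)) (Q ω - x)
    rw [charFun_apply_real] at h2
    push_cast
    have h3 : ((Real.toNNReal (ε⁻¹ ^ 2) : ℝ) : ℂ) = ((ε⁻¹ ^ 2 : ℝ) : ℂ) := by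
      rw [Real.coe_toNNReal _ (by positivity)]
    refine Eq.trans ?_ (h2.symm.trans (integral_congr_ae
      (Filter.Eventually.of_forall fun s ↦ ?_)))
    · rw [h3]
      push_cast
      congr 1
      ring
    · push_cast
      congr 1
      ring
  rw [← integral_complex_ofReal]
  simp_rw [h1]
  rw [integral_integral_swap]
  · refine integral_congr_ae (Filter.Eventually.of_forall fun s ↦ ?_)
    simp only
    rw [← integral_const_mul]
    refine integral_congr_ae (Filter.Eventually.of_forall fun ω ↦ ?_)
    simp only
    rw [← Complex.exp_add]
    congr 1
    push_cast
    ring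
  · have hQ' : AEMeasurable (fun p : Ω × ℝ ↦ Q p.1)
        (P.prod (gaussianReal 0 (Real.toNNReal (ε⁻¹ ^ 2)))) :=
      hQ.comp_quasiMeasurePreserving Measure.quasiMeasurePreserving_fst
    refine Integrable.of_bound (C := 1) ?_ (Filter.Eventually.of_forall fun p ↦ ?_)
    · refine AEMeasurable.aestronglyMeasurable ?_
      simp only [Function.uncurry_def]
      fun_prop
    · simp only [Function.uncurry_def, Complex.norm_exp_ofReal_mul_I, le_refl]

/-- A smoothing inequality: small ball probabilities are controlled by the `L¹` norm of the
characteristic function. -/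
lemma measure_lt_lt_add_le {Q : Ω → ℝ} (hQ : AEMeasurable Q P) {g : ℝ → ℝ} (hg : Integrable g)
    (hle : ∀ᵐ t : ℝ, ‖∫ ω, Complex.exp (t * Q ω * Complex.I) ∂P‖ ≤ g t) (x : ℝ) {ε : ℝ}
    (hε : 0 < ε) :
    P {ω | x < Q ω ∧ Q ω < x + ε} ≤ ENNReal.ofReal (ε * ∫ t, g t) := by
  have hg0 : 0 ≤ᵐ[volume] g := hle.mono fun t ht ↦ (norm_nonneg _).trans ht
  set F : Ω → ℝ := fun ω ↦ Real.exp (-(Q ω - x) ^ 2 * ε⁻¹ ^ 2 / 2) with hF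
  have hFm : AEMeasurable F P := by fun_prop
  have hFi : Integrable F P := by
    refine Integrable.of_bound hFm.aestronglyMeasurable (C := 1)
      (Filter.Eventually.of_forall fun ω ↦ ?_)
    rw [Real.norm_of_nonneg (Real.exp_pos _).le, Real.exp_le_one_iff, neg_mul, neg_div]
    exact neg_nonpos.2 (by positivity)
  -- On the interval the bump is at least `exp (-1/2) ≥ 1/2`, so Markov's inequality applies.
  have h1 : P {ω | x < Q ω ∧ Q ω < x + ε} ≤ P {ω | 2⁻¹ ≤ ENNReal.ofReal (F ω)} := by
    refine measure_mono fun ω hω ↦ ?_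
    have h2 : (Q ω - x) ^ 2 * ε⁻¹ ^ 2 ≤ 1 := by
      rw [← mul_pow, ← div_eq_mul_inv]
      have h3 : (Q ω - x) / ε ≤ 1 := by
        rw [div_le_one hε]
        linarith [hω.2]
      have h4 : 0 ≤ (Q ω - x) / ε := div_nonneg (by linarith [hω.1]) hε.le
      exact pow_le_one₀ h4 h3
    have h5 : (2⁻¹ : ℝ) ≤ F ω := by
      have := Real.add_one_le_exp (-(Q ω - x) ^ 2 * ε⁻¹ ^ 2 / 2)
      simp only [hF]
      linarith
    have h6 := ENNReal.ofReal_le_ofReal h5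
    rwa [ENNReal.ofReal_inv_of_pos two_pos, ENNReal.ofReal_ofNat] at h6
  have h2 : 2⁻¹ * P {ω | x < Q ω ∧ Q ω < x + ε} ≤ ENNReal.ofReal (∫ ω, F ω ∂P) := by
    rw [ofReal_integral_eq_lintegral_ofReal hFi
      (Filter.Eventually.of_forall fun ω ↦ (Real.exp_pos _).le)]
    exact (mul_le_mul_right h1 _).trans (mul_meas_ge_le_lintegral₀ hFm.ennreal_ofReal _)
  have h3 : ENNReal.ofReal (∫ ω, F ω ∂P) ≤ ENNReal.ofReal (ε / 2 * ∫ t, g t) := by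
    have h4 : ENNReal.ofReal (∫ ω, F ω ∂P) = ‖((∫ ω, F ω ∂P : ℝ) : ℂ)‖ₑ := by
      rw [← ofReal_norm, Complex.norm_real,
        Real.norm_of_nonneg (integral_nonneg fun ω ↦ (Real.exp_pos _).le)]
    rw [h4, integral_exp_neg_sq_eq hQ x ε]
    refine (enorm_integral_le_lintegral_enorm _).trans ?_
    refine (lintegral_mono' (gaussianReal_le_smul_volume (by simpa using hε.ne')) le_rfl).trans ?_
    have h5 : (2 * √(Real.toNNReal (ε⁻¹ ^ 2) : ℝ))⁻¹ = ε / 2 := by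
      rw [Real.coe_toNNReal _ (by positivity), Real.sqrt_sq (by positivity)]
      field_simp
    rw [h5, lintegral_smul_measure, ENNReal.ofReal_mul (by positivity),
      ofReal_integral_eq_lintegral_ofReal hg hg0, smul_eq_mul]
    refine mul_le_mul_right (lintegral_mono_ae (hle.mono fun t ht ↦ ?_)) _
    rw [← ofReal_norm, norm_mul, ← Complex.ofReal_neg, Complex.norm_exp_ofReal_mul_I, one_mul]
    exact ENNReal.ofReal_le_ofReal ht
  calc P {ω | x < Q ω ∧ Q ω < x + ε}
      = 2 * (2⁻¹ * P {ω | x < Q ω ∧ Q ω < x + ε}) := by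
        rw [← mul_assoc, ENNReal.mul_inv_cancel (by simp) (by simp), one_mul]
    _ ≤ 2 * ENNReal.ofReal (ε / 2 * ∫ t, g t) := mul_le_mul_right (h2.trans h3) _
    _ = ENNReal.ofReal (ε * ∫ t, g t) := by
        rw [← ENNReal.ofReal_ofNat 2, ← ENNReal.ofReal_mul (by simp)]
        congr 1
        ring

end Smoothing

/-! ### Lower bounds for products and integrable majorants. -/

section Products

/-- The witnesses are the elementary symmetric sums of degrees 2 and 3, built by their recursion.
With `S` the sum, `S² = 2 e₂ + ∑ x_i²` and `S e₂ = 3 e₃ + ∑_{i<j} x_i x_j (x_i + x_j)`; the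
corrections are at most `m S` and `2 m e₂`. -/
lemma exists_symmetric_sums_le_prod {ι : Type*} (s : Finset ι) {x : ι → ℝ} {m : ℝ}
    (h0 : ∀ i ∈ s, 0 ≤ x i) (hm : ∀ i ∈ s, x i ≤ m) :
    ∃ e₂ e₃ : ℝ, 0 ≤ e₂ ∧ 0 ≤ e₃ ∧ 1 + ∑ i ∈ s, x i + e₂ + e₃ ≤ ∏ i ∈ s, (1 + x i) ∧
      (∑ i ∈ s, x i) * (∑ i ∈ s, x i - m) ≤ 2 * e₂ ∧
      e₂ * (∑ i ∈ s, x i - 2 * m) ≤ 3 * e₃ := by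
  classical
  induction s using Finset.induction_on with
  | empty => exact ⟨0, 0, by simp⟩
  | insert i s hi ih =>
    obtain ⟨e₂, e₃, he₂, he₃, h1, h2, h3⟩ := ih (fun j hj ↦ h0 j (Finset.mem_insert_of_mem hj))
      fun j hj ↦ hm j (Finset.mem_insert_of_mem hj)
    have hx0 := h0 i (Finset.mem_insert_self i s)
    have hxm := hm i (Finset.mem_insert_self i s)
    have hS : 0 ≤ ∑ j ∈ s, x j :=
      Finset.sum_nonneg fun j hj ↦ h0 j (Finset.mem_insert_of_mem hj)
    rw [Finset.sum_insert hi, Finset.prod_insert hi]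
    set S := ∑ j ∈ s, x j
    refine ⟨e₂ + x i * S, e₃ + x i * e₂, by positivity, by positivity, ?_, ?_, ?_⟩
    · nlinarith [mul_le_mul_of_nonneg_left h1 (by linarith : 0 ≤ 1 + x i), mul_nonneg hx0 he₃]
    · nlinarith [mul_le_mul_of_nonneg_left hxm hx0]
    · have h4 : S * (S + x i - 2 * m) ≤ 2 * e₂ := by nlinarith
      nlinarith [mul_le_mul_of_nonneg_left h4 hx0]

lemma one_add_cube_le_prod {ι : Type*} (s : Finset ι) {x : ι → ℝ} (h0 : ∀ i ∈ s, 0 ≤ x i)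
    (hm : ∀ i ∈ s, x i ≤ 2 / 5 * ∑ j ∈ s, x j) :
    1 + (∑ j ∈ s, x j) ^ 3 / 50 ≤ ∏ i ∈ s, (1 + x i) := by
  obtain ⟨e₂, e₃, he₂, he₃, h1, h2, h3⟩ := exists_symmetric_sums_le_prod s h0 hm
  have hS : 0 ≤ ∑ j ∈ s, x j := Finset.sum_nonneg h0
  set S := ∑ j ∈ s, x j
  -- Here `m = 2S/5`; any `m` below `S/2` keeps `S - 2m` positive. Then `e₃ ≥ (1/15) S e₂ ≥ S³/50`.
  have h4 : 3 / 10 * S ^ 2 ≤ e₂ := by nlinarith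
  have h5 : 3 / 10 * S ^ 2 * S ≤ e₂ * S := mul_le_mul_of_nonneg_right h4 hS
  nlinarith

/-- A majorant of characteristic functions whose decay is of order `3/2`. -/
noncomputable def charFunMajorant (s : ℝ) : ℝ := (1 + s ^ 6) ^ (-(1 / 4) : ℝ)

lemma charFunMajorant_nonneg (s : ℝ) : 0 ≤ charFunMajorant s := by
  unfold charFunMajorant
  have : 0 ≤ s ^ 6 := by positivity
  positivity

lemma measurable_charFunMajorant : Measurable charFunMajorant := by
  unfold charFunMajorant
  fun_prop

lemma integrable_charFunMajorant : Integrable charFunMajorant := by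
  have h1 : Integrable (fun s : ℝ ↦ (32 : ℝ) ^ (1 / 4 : ℝ) * (1 + ‖s‖) ^ (-(3 / 2) : ℝ)) :=
    (integrable_one_add_norm (by norm_num)).const_mul _
  refine h1.mono' measurable_charFunMajorant.aestronglyMeasurable
    (Filter.Eventually.of_forall fun s ↦ ?_)
  rw [Real.norm_of_nonneg (charFunMajorant_nonneg s), charFunMajorant]
  have hs : 0 ≤ ‖s‖ := norm_nonneg s
  have h2 : (1 + ‖s‖) ^ 6 ≤ 32 * (1 + s ^ 6) := by
    have h3 : s ^ 6 = ‖s‖ ^ 6 := by rw [← norm_pow, Real.norm_of_nonneg (by positivity)]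
    rw [h3]
    have := add_pow_le zero_le_one hs 6
    norm_num at this ⊢
    linarith
  have h4 : (1 + ‖s‖) ^ (-(3 / 2) : ℝ) = ((1 + ‖s‖) ^ 6) ^ (-(1 / 4) : ℝ) := by
    rw [← Real.rpow_natCast, ← Real.rpow_mul (by positivity)]
    norm_num
  have h5 : (1 + s ^ 6) ^ (-(1 / 4) : ℝ) =
      (32 : ℝ) ^ (1 / 4 : ℝ) * (32 * (1 + s ^ 6)) ^ (-(1 / 4) : ℝ) := by
    have : 0 ≤ s ^ 6 := by positivity
    rw [Real.mul_rpow (by norm_num) (by positivity), ← mul_assoc,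
      ← Real.rpow_add (by norm_num)]
    norm_num
  rw [h4, h5]
  refine mul_le_mul_of_nonneg_left ?_ (by positivity)
  exact Real.rpow_le_rpow_of_nonpos (by positivity) h2 (by norm_num)

/-- A majorant of characteristic functions with one dominating factor. -/
noncomputable def singularMajorant (s : ℝ) : ℝ := |s| ^ (-(1 / 2) : ℝ) * charFunMajorant s

lemma singularMajorant_nonneg (s : ℝ) : 0 ≤ singularMajorant s :=
  mul_nonneg (by positivity) (charFunMajorant_nonneg s)

lemma measurable_singularMajorant : Measurable singularMajorant := by
  have := measurable_charFunMajorant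
  unfold singularMajorant
  fun_prop

lemma integrable_singularMajorant : Integrable singularMajorant := by
  have h1 : IntegrableOn singularMajorant (Set.Ioc 0 1) := by
    have h2 : IntegrableOn (fun s : ℝ ↦ s ^ (-(1 / 2) : ℝ)) (Set.Ioc 0 1) :=
      (intervalIntegrable_iff_integrableOn_Ioc_of_le zero_le_one).1
        (intervalIntegral.intervalIntegrable_rpow' (by norm_num))
    refine h2.mono' measurable_singularMajorant.aestronglyMeasurable
      ((ae_restrict_iff' measurableSet_Ioc).2 (Filter.Eventually.of_forall fun s hs ↦ ?_))
    rw [Real.norm_of_nonneg (singularMajorant_nonneg s), singularMajorant, abs_of_pos hs.1]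
    refine mul_le_of_le_one_right (Real.rpow_nonneg hs.1.le _) ?_
    exact Real.rpow_le_one_of_one_le_of_nonpos (by nlinarith [pow_pos hs.1 6]) (by norm_num)
  have h3 : IntegrableOn singularMajorant (Set.Ioi 1) := by
    refine integrable_charFunMajorant.integrableOn.mono'
      measurable_singularMajorant.aestronglyMeasurable
      ((ae_restrict_iff' measurableSet_Ioi).2 (Filter.Eventually.of_forall fun s hs ↦ ?_))
    have hs' : (1 : ℝ) < s := hs
    rw [Real.norm_of_nonneg (singularMajorant_nonneg s), singularMajorant,
      abs_of_pos (one_pos.trans hs')]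
    exact mul_le_of_le_one_left (charFunMajorant_nonneg s)
      (Real.rpow_le_one_of_one_le_of_nonpos hs'.le (by norm_num))
  have h4 : Integrable ((Set.Ioi 0).indicator singularMajorant) := by
    rw [integrable_indicator_iff measurableSet_Ioi, ← Set.Ioc_union_Ioi_eq_Ioi zero_le_one]
    exact h1.union h3
  -- Evenness; at `s = 0` both sides vanish because `0 ^ (-1/2) = 0` by convention.
  have h5 : singularMajorant = fun s ↦ (Set.Ioi 0).indicator singularMajorant s +
      (Set.Ioi 0).indicator singularMajorant (-1 * s) := by
    ext s
    rcases lt_trichotomy s 0 with hs | rfl | hs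
    · simp [hs, hs.le, singularMajorant, charFunMajorant, Even.neg_pow (by decide : Even 6)]
    · simp [singularMajorant]
    · simp [hs, hs.le]
  rw [h5]
  exact h4.add (h4.comp_mul_left' (by norm_num))

end Products

/-! ### The three concentration bounds for given eigenvectors. -/

section Concentration

open scoped InnerProductSpace

lemma prod_rpow_le_charFunMajorant {ι : Type*} (s : Finset ι) {μ : ι → ℝ}
    (hm : ∀ i ∈ s, μ i ^ 2 ≤ 2 / 5 * ∑ j ∈ s, μ j ^ 2) (t : ℝ) :
    ∏ i ∈ s, (1 + 4 * t ^ 2 * μ i ^ 2) ^ (-(1 / 4) : ℝ) ≤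
      charFunMajorant (√(∑ j ∈ s, μ j ^ 2) * t) := by
  have hL : 0 ≤ ∑ j ∈ s, μ j ^ 2 := Finset.sum_nonneg fun _ _ ↦ sq_nonneg _
  rw [Real.finsetProd_rpow _ _ (fun i _ ↦ by positivity), charFunMajorant]
  have h1 := one_add_cube_le_prod s (x := fun i ↦ 4 * t ^ 2 * μ i ^ 2)
    (fun i _ ↦ by positivity) fun i hi ↦ by
      rw [← Finset.mul_sum]
      nlinarith [mul_le_mul_of_nonneg_left (hm i hi) (by positivity : 0 ≤ 4 * t ^ 2)]
  rw [← Finset.mul_sum] at h1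
  have h2 : (√(∑ j ∈ s, μ j ^ 2) * t) ^ 6 = (t ^ 2 * ∑ j ∈ s, μ j ^ 2) ^ 3 := by
    rw [mul_pow, mul_pow, show (6 : ℕ) = 2 * 3 by norm_num, pow_mul, pow_mul,
      Real.sq_sqrt hL]
    ring
  have h3 : 0 ≤ (t ^ 2 * ∑ j ∈ s, μ j ^ 2) ^ 3 := by positivity
  rw [h2]
  -- The factor 4 in `4 t² μ²` pays for the constant: `4³ / 50 ≥ 1`.
  refine Real.rpow_le_rpow_of_nonpos (by positivity) (le_trans ?_ h1) (by norm_num)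
  nlinarith

lemma volume_annulus_le (w : ℂ) (x : ℝ) {ε : ℝ} (hε : 0 < ε) :
    volume {z : ℂ | x < ‖z - w‖ ^ 2 ∧ ‖z - w‖ ^ 2 < x + ε} ≤ ENNReal.ofReal (4 * ε) := by
  have hball : {z : ℂ | x < ‖z - w‖ ^ 2 ∧ ‖z - w‖ ^ 2 < x + ε} ⊆ Metric.ball w √(x + ε) := by
    intro z hz
    rw [mem_ball_iff_norm]
    exact Real.lt_sqrt_of_sq_lt hz.2
  have hvol : ∀ r : ℝ, 0 ≤ r → volume (Metric.ball w √r) = ENNReal.ofReal (Real.pi * r) := by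
    intro r hr
    rw [Complex.volume_ball, ← ENNReal.ofReal_pow (Real.sqrt_nonneg _), Real.sq_sqrt hr,
      ← ENNReal.ofReal_coe_nnreal, ← ENNReal.ofReal_mul hr, NNReal.coe_real_pi, mul_comm]
  -- Negative `x` does occur: the squared residual is later subtracted from it.
  rcases lt_or_ge (x + ε) 0 with h | h
  · rw [Real.sqrt_eq_zero_of_nonpos h.le, Metric.ball_zero] at hball
    simp [Set.subset_empty_iff.1 hball]
  rcases lt_or_ge x 0 with hx | hx
  · refine (measure_mono hball).trans ?_
    rw [hvol _ h]
    exact ENNReal.ofReal_le_ofReal (by nlinarith [Real.pi_lt_four, Real.pi_pos])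
  · have hsub : {z : ℂ | x < ‖z - w‖ ^ 2 ∧ ‖z - w‖ ^ 2 < x + ε} ⊆
        Metric.ball w √(x + ε) \ Metric.ball w √x := by
      refine fun z hz ↦ ⟨hball hz, fun h2 ↦ ?_⟩
      rw [mem_ball_iff_norm, Real.lt_sqrt (norm_nonneg _)] at h2
      exact lt_asymm h2 hz.1
    refine (measure_mono hsub).trans ?_
    rw [measure_sdiff (Metric.ball_subset_ball (Real.sqrt_le_sqrt (by linarith)))
      measurableSet_ball.nullMeasurableSet (by rw [hvol x hx]; simp), hvol _ h, hvol _ hx,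
      ← ENNReal.ofReal_sub _ (by positivity)]
    exact ENNReal.ofReal_le_ofReal (by nlinarith [Real.pi_lt_four, Real.pi_pos])

lemma volume_prod_annulus_le (b c x : ℝ) {ε : ℝ} (hε : 0 < ε) :
    volume {y : ℝ × ℝ | x < (y.1 - b) ^ 2 + (y.2 - c) ^ 2 ∧
      (y.1 - b) ^ 2 + (y.2 - c) ^ 2 < x + ε} ≤ ENNReal.ofReal (4 * ε) := by
  have h := volume_annulus_le ⟨b, c⟩ x hε
  rw [← Complex.volume_preserving_equiv_real_prod.symm.measure_preimage_equiv] at h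
  have h1 : ∀ y : ℝ × ℝ, ‖(⟨y.1, y.2⟩ - ⟨b, c⟩ : ℂ)‖ ^ 2 =
      (y.1 - b) ^ 2 + (y.2 - c) ^ 2 := fun y ↦ by
    rw [Complex.sq_norm, Complex.normSq_apply, Complex.sub_re, Complex.sub_im, sq, sq]
  convert h using 3
  ext y
  simp only [Set.mem_preimage, Set.mem_ofPred_eq, Complex.measurableEquivRealProd_symm_apply, h1]

variable {Ω : Type*} [MeasurableSpace Ω] {P : Measure Ω} [IsProbabilityMeasure P]
  {H : Type*} [NormedAddCommGroup H] [InnerProductSpace ℝ H] [CompleteSpace H]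
  [SecondCountableTopology H] [MeasurableSpace H] [BorelSpace H] {ξ : Ω → H}

lemma measure_norm_sq_le_of_no_dominating (hξ : HasGaussianLaw ξ P) (h0 : ∫ ω, ξ ω ∂P = 0)
    {ι : Type*} [Fintype ι] {v : ι → H} {μ : ι → ℝ}
    (hv : Orthonormal ℝ v) (hμ : ∀ i, covarianceOperator (P.map ξ) (v i) = μ i • v i)
    (hpos : ∀ i, 0 < μ i) (hL : 0 < ∑ j, μ j ^ 2)
    (hm : ∀ i, μ i ^ 2 ≤ 2 / 5 * ∑ j, μ j ^ 2) (a : H) (x : ℝ) {ε : ℝ} (hε : 0 < ε) :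
    P {ω | x < ‖ξ ω - a‖ ^ 2 ∧ ‖ξ ω - a‖ ^ 2 < x + ε} ≤
      ENNReal.ofReal (ε * ((√(∑ j, μ j ^ 2))⁻¹ * ∫ s, charFunMajorant s)) := by
  have haem := hξ.aemeasurable
  have hc : √(∑ j, μ j ^ 2) ≠ 0 := (Real.sqrt_pos.2 hL).ne'
  have h1 := measure_lt_lt_add_le (P := P) (Q := fun ω ↦ ‖ξ ω - a‖ ^ 2) (by fun_prop)
    (integrable_charFunMajorant.comp_mul_left' hc)
    (Filter.Eventually.of_forall fun t ↦
      (norm_integral_cexp_norm_sq_le hξ h0 hv hμ hpos a t).trans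
        (prod_rpow_le_charFunMajorant _ (fun i _ ↦ hm i) t)) x hε
  rwa [Measure.integral_comp_mul_left, abs_of_nonneg (by positivity), smul_eq_mul] at h1

lemma measure_norm_sq_le_of_one_dominating (hξ : HasGaussianLaw ξ P) (h0 : ∫ ω, ξ ω ∂P = 0)
    {n : ℕ} {v : Fin (n + 1) → H} {μ : Fin (n + 1) → ℝ}
    (hv : Orthonormal ℝ v) (hμ : ∀ i, covarianceOperator (P.map ξ) (v i) = μ i • v i)
    (hpos : ∀ i, 0 < μ i) (hL : 0 < ∑ j : Fin n, μ j.succ ^ 2)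
    (hm : ∀ i : Fin n, μ i.succ ^ 2 ≤ 2 / 5 * ∑ j : Fin n, μ j.succ ^ 2) (a : H) (x : ℝ)
    {ε : ℝ} (hε : 0 < ε) :
    P {ω | x < ‖ξ ω - a‖ ^ 2 ∧ ‖ξ ω - a‖ ^ 2 < x + ε} ≤
      ENNReal.ofReal (ε * ((μ 0 * √(∑ j : Fin n, μ j.succ ^ 2)) ^ (-(1 / 2) : ℝ) *
        ∫ s, singularMajorant s)) := by
  have haem := hξ.aemeasurable
  set c := √(∑ j : Fin n, μ j.succ ^ 2) with hcdef
  have hc : 0 < c := Real.sqrt_pos.2 hL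
  have hμ0 := hpos 0
  have hbound : ∀ᵐ t : ℝ, ‖∫ ω, Complex.exp (t * (‖ξ ω - a‖ ^ 2 : ℝ) * Complex.I) ∂P‖ ≤
      (μ 0 / c) ^ (-(1 / 2) : ℝ) * singularMajorant (c * t) := by
    -- At `t = 0` the majorant is 0 by convention and the bound fails.
    filter_upwards [Measure.ae_ne volume (0 : ℝ)] with t ht
    refine (norm_integral_cexp_norm_sq_le hξ h0 hv hμ hpos a t).trans ?_
    rw [Fin.prod_univ_succ, singularMajorant, ← mul_assoc,
      ← Real.mul_rpow (by positivity) (by positivity)]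
    refine mul_le_mul ?_ (prod_rpow_le_charFunMajorant Finset.univ (fun i _ ↦ hm i) t)
      (Finset.prod_nonneg fun i _ ↦ by positivity) (by positivity)
    have ht' : 0 < |t| := abs_pos.2 ht
    have h2 : μ 0 / c * |c * t| = μ 0 * |t| := by
      rw [abs_mul, abs_of_pos hc]
      field_simp
    have h3 : (μ 0 * |t|) ^ (-(1 / 2) : ℝ) = ((μ 0 * |t|) ^ 2) ^ (-(1 / 4) : ℝ) := by
      rw [← Real.rpow_natCast, ← Real.rpow_mul (by positivity)]
      norm_num
    rw [h2, h3]
    refine Real.rpow_le_rpow_of_nonpos (by positivity) ?_ (by norm_num)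
    rw [mul_pow, sq_abs]
    nlinarith [mul_nonneg (sq_nonneg t) (sq_nonneg (μ 0))]
  have h1 := measure_lt_lt_add_le (P := P) (Q := fun ω ↦ ‖ξ ω - a‖ ^ 2) (by fun_prop)
    ((integrable_singularMajorant.comp_mul_left' hc.ne').const_mul _) hbound x hε
  rw [integral_const_mul, Measure.integral_comp_mul_left, abs_of_nonneg (by positivity),
    smul_eq_mul, ← mul_assoc (_ ^ _)] at h1
  convert h1 using 4
  have hc2 : c⁻¹ = (c ^ 2) ^ (-(1 / 2) : ℝ) := by
    rw [← Real.rpow_natCast, ← Real.rpow_mul hc.le, ← Real.rpow_neg_one]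
    norm_num
  rw [hc2, ← Real.mul_rpow (by positivity) (by positivity)]
  congr 1
  field_simp

/-- With the residual fixed, the event is that a plane Gaussian vector lies in an annulus, so
bounded density and area suffice. -/
lemma measure_norm_sq_le_of_two_dominating (hξ : HasGaussianLaw ξ P) (h0 : ∫ ω, ξ ω ∂P = 0)
    {v : Fin 2 → H} {μ : Fin 2 → ℝ}
    (hv : Orthonormal ℝ v) (hμ : ∀ i, covarianceOperator (P.map ξ) (v i) = μ i • v i)
    (hpos : ∀ i, 0 < μ i) (a : H) (x : ℝ) {ε : ℝ} (hε : 0 < ε) :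
    P {ω | x < ‖ξ ω - a‖ ^ 2 ∧ ‖ξ ω - a‖ ^ 2 < x + ε} ≤
      ENNReal.ofReal (ε * (μ 0 * μ 1) ^ (-(1 / 2) : ℝ)) := by
  have haem := hξ.aemeasurable
  set Y : Ω → ℝ × ℝ := fun ω ↦ (⟪v 0, ξ ω⟫_ℝ, ⟪v 1, ξ ω⟫_ℝ) with hY
  set R : Ω → H := fun ω ↦ orthonormalResidual v (ξ ω) with hR
  have hYm : AEMeasurable Y P := by fun_prop
  have hRm : AEMeasurable R P := by fun_prop
  have hYR : IndepFun Y R P :=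
    (indepFun_inner_residual hξ h0 hv hμ).comp (φ := fun y : Fin 2 → ℝ ↦ (y 0, y 1))
      (by fun_prop) measurable_id
  have hYlaw : P.map Y = (gaussianReal 0 (μ 0).toNNReal).prod (gaussianReal 0 (μ 1).toNNReal) := by
    rw [← map_inner_eq_gaussianReal hξ h0 hv hμ 0, ← map_inner_eq_gaussianReal hξ h0 hv hμ 1]
    exact (indepFun_iff_map_prod_eq_prod_map_map (by fun_prop) (by fun_prop)).1
      ((iIndepFun_inner hξ h0 hv hμ).indepFun (by decide))
  have hYle : P.map Y ≤ ENNReal.ofReal (4 * √(μ 0 * μ 1))⁻¹ • volume := by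
    rw [hYlaw]
    refine (Measure.prod_mono (gaussianReal_le_smul_volume (by simpa using hpos 0))
      (gaussianReal_le_smul_volume (by simpa using hpos 1))).trans_eq ?_
    rw [Measure.prod_smul_left, Measure.prod_smul_right, smul_smul,
      ← ENNReal.ofReal_mul (by positivity), Real.coe_toNNReal _ (hpos 0).le,
      Real.coe_toNNReal _ (hpos 1).le, Real.sqrt_mul (hpos 0).le, ← mul_inv]
    congr 3
    ring
  set F : (ℝ × ℝ) × H → ℝ := fun p ↦ (p.1.1 - ⟪v 0, a⟫_ℝ) ^ 2 + (p.1.2 - ⟪v 1, a⟫_ℝ) ^ 2 +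
    ‖p.2 - orthonormalResidual v a‖ ^ 2 with hF
  have hFm : Measurable F := by fun_prop
  set S : Set ((ℝ × ℝ) × H) := F ⁻¹' Set.Ioo x (x + ε) with hS
  have hSm : MeasurableSet S := hFm measurableSet_Ioo
  have hev : {ω | x < ‖ξ ω - a‖ ^ 2 ∧ ‖ξ ω - a‖ ^ 2 < x + ε} = (fun ω ↦ (Y ω, R ω)) ⁻¹' S := by
    ext ω
    simp only [hS, hF, hY, hR, Set.mem_ofPred_eq, Set.mem_preimage, Set.mem_Ioo,
      norm_sq_eq_sum_add_residual hv
      (ξ ω - a), Fin.sum_univ_two, inner_sub_right, map_sub]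
  have := Measure.isProbabilityMeasure_map (μ := P) hYm
  have := Measure.isProbabilityMeasure_map (μ := P) hRm
  rw [hev, ← Measure.map_apply_of_aemeasurable (hYm.prodMk hRm) hSm,
    (indepFun_iff_map_prod_eq_prod_map_map hYm hRm).1 hYR, Measure.prod_apply_symm hSm]
  have hsec : ∀ r : H, P.map Y ((fun y ↦ (y, r)) ⁻¹' S) ≤
      ENNReal.ofReal (ε * (μ 0 * μ 1) ^ (-(1 / 2) : ℝ)) := fun r ↦ by
    refine (hYle _).trans ?_
    have h1 := volume_prod_annulus_le ⟪v 0, a⟫_ℝ ⟪v 1, a⟫_ℝ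
      (x - ‖r - orthonormalResidual v a‖ ^ 2) hε
    have h2 : (fun y ↦ (y, r)) ⁻¹' S = {y : ℝ × ℝ | x - ‖r - orthonormalResidual v a‖ ^ 2 <
        (y.1 - ⟪v 0, a⟫_ℝ) ^ 2 + (y.2 - ⟪v 1, a⟫_ℝ) ^ 2 ∧
        (y.1 - ⟪v 0, a⟫_ℝ) ^ 2 + (y.2 - ⟪v 1, a⟫_ℝ) ^ 2 <
          x - ‖r - orthonormalResidual v a‖ ^ 2 + ε} := by
      ext y
      simp only [hS, hF, Set.mem_preimage, Set.mem_Ioo, Set.mem_ofPred_eq]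
      constructor <;> rintro ⟨h3, h4⟩ <;> constructor <;> linarith
    rw [h2, Measure.smul_apply, smul_eq_mul]
    refine (mul_le_mul_right h1 _).trans_eq ?_
    rw [← ENNReal.ofReal_mul (by positivity)]
    congr 1
    rw [Real.rpow_neg (mul_pos (hpos 0) (hpos 1)).le, ← Real.sqrt_eq_rpow]
    have : 0 < √(μ 0 * μ 1) := Real.sqrt_pos.2 (mul_pos (hpos 0) (hpos 1))
    field_simp
  refine (lintegral_mono hsec).trans ?_
  simp

end Concentration

/-! ### Tails of the eigenvalue sequence. -/

section Tails

variable {H : Type*} [NormedAddCommGroup H] [InnerProductSpace ℝ H]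

lemma eigenvalueTail_sq (T : H →L[ℝ] H) (k : ℕ) :
    eigenvalueTail T k ^ 2 = ∑' j : ℕ, ENNReal.ofReal (orderedEigenvalue T (k + j)) ^ 2 := by
  rw [eigenvalueTail, ← ENNReal.rpow_natCast, ← ENNReal.rpow_mul]
  norm_num

lemma eigenvalueTail_two_le_one (T : H →L[ℝ] H) : eigenvalueTail T 2 ≤ eigenvalueTail T 1 := by
  refine ENNReal.rpow_le_rpow ?_ (by norm_num)
  have h := ENNReal.tsum_comp_le_tsum_of_injective (f := fun j : ℕ ↦ j + 1)
    (add_left_injective 1) fun j ↦ ENNReal.ofReal (orderedEigenvalue T (1 + j)) ^ 2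
  refine le_trans (le_of_eq (tsum_congr fun j ↦ ?_)) h
  rw [show 1 + (j + 1) = 2 + j by ring]

lemma rpow_neg_half_le_of_le_four_mul {a b : ℝ≥0∞} (h : a ≤ 4 * b) :
    b ^ (-(1 / 2) : ℝ) ≤ 2 * a ^ (-(1 / 2) : ℝ) := by
  have h4 : (4 : ℝ≥0∞) ^ (1 / 2 : ℝ) = 2 := by
    rw [show (4 : ℝ≥0∞) = 2 ^ (2 : ℝ) by norm_num, ← ENNReal.rpow_mul]
    norm_num
  have h1 : a ^ (1 / 2 : ℝ) ≤ 2 * b ^ (1 / 2 : ℝ) := by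
    rw [← h4, ← ENNReal.mul_rpow_of_nonneg _ _ (by norm_num)]
    exact ENNReal.rpow_le_rpow h (by norm_num)
  rw [ENNReal.rpow_neg, ENNReal.rpow_neg]
  calc (b ^ (1 / 2 : ℝ))⁻¹ = 2 * (2 * b ^ (1 / 2 : ℝ))⁻¹ := by
        rw [ENNReal.mul_inv (by simp) (by simp), ← mul_assoc,
          ENNReal.mul_inv_cancel (by simp) (by simp), one_mul]
    _ ≤ 2 * (a ^ (1 / 2 : ℝ))⁻¹ := mul_le_mul_right (ENNReal.inv_le_inv.2 h1) _

lemma le_two_mul_of_sq_lt_three_mul_sq {a b : ℝ≥0∞} (h : a ^ 2 < 3 * b ^ 2) : a ≤ 2 * b := by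
  have h1 : a ^ 2 ≤ (2 * b) ^ 2 := by
    rw [mul_pow]
    refine h.le.trans (mul_le_mul_left ?_ _)
    norm_num
  exact (ENNReal.pow_le_pow_left_iff two_ne_zero).1 h1

/-- A failed test `3 λ_k² ≤ Λ_k²` means `Λ_k ≤ 2 λ_k`. At worst this is used for both `k = 1` and `k
= 2`, and the square root of `2 · 2` is the constant. -/
lemma varkappa_le (T : H →L[ℝ] H) :
    varkappa T ≤ 2 * (eigenvalueTail T 1 * eigenvalueTail T 2) ^ (-(1 / 2) : ℝ) := by
  unfold varkappa
  split_ifs with h1 h2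
  · have h3 : (eigenvalueTail T 1)⁻¹ =
        (eigenvalueTail T 1 * eigenvalueTail T 1) ^ (-(1 / 2) : ℝ) := by
      rw [← sq, ← ENNReal.rpow_natCast, ← ENNReal.rpow_mul, ← ENNReal.rpow_neg_one]
      norm_num
    rw [h3]
    refine rpow_neg_half_le_of_le_four_mul ?_
    refine (mul_le_mul_right (eigenvalueTail_two_le_one T) _).trans ?_
    exact le_mul_of_one_le_left zero_le (by norm_num)
  · refine rpow_neg_half_le_of_le_four_mul ?_
    have h3 := le_two_mul_of_sq_lt_three_mul_sq (not_le.1 h1)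
    calc eigenvalueTail T 1 * eigenvalueTail T 2
        ≤ 2 * ENNReal.ofReal (orderedEigenvalue T 1) * eigenvalueTail T 2 := by gcongr
      _ ≤ 4 * (ENNReal.ofReal (orderedEigenvalue T 1) * eigenvalueTail T 2) := by
        rw [mul_assoc]
        gcongr
        norm_num
  · refine rpow_neg_half_le_of_le_four_mul ?_
    have h3 := le_two_mul_of_sq_lt_three_mul_sq (not_le.1 h1)
    have h4 := le_two_mul_of_sq_lt_three_mul_sq (not_le.1 h2)
    refine (mul_le_mul' h3 h4).trans_eq ?_
    ring

lemma orderedEigenvalue_nonneg {T : H →L[ℝ] H} (hT : ∀ x, 0 ≤ inner ℝ (T x) x) (k : ℕ) :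
    0 ≤ orderedEigenvalue T k := by
  rcases Set.eq_empty_or_nonempty {t : ℝ | ∃ v : Fin k → H, Orthonormal ℝ v ∧
      ∀ i, ∃ μ : ℝ, t ≤ μ ∧ T (v i) = μ • v i} with h | ⟨t, v, hv, hs⟩
  · simp [orderedEigenvalue, h]
  · refine Real.sSup_nonneg' ⟨0, ⟨v, hv, fun i ↦ ?_⟩, le_rfl⟩
    obtain ⟨μ, -, hμ⟩ := hs i
    refine ⟨μ, ?_, hμ⟩
    have := hT (v i)
    rwa [hμ, inner_smul_left, real_inner_self_eq_norm_sq, hv.1, one_pow, mul_one] at this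

/-- Almost optimal eigenvectors exist only for positive ordered eigenvalues, so vanishing terms are
cut off; `d` counts the leading eigenvalues left out of the sum. -/
lemma exists_positive_prefix (T : H →L[ℝ] H) {d : ℕ}
    (hd : ∀ i < d, 0 < orderedEigenvalue T (i + 1)) (n : ℕ) :
    ∃ m, (∀ i < d + m, 0 < orderedEigenvalue T (i + 1)) ∧
      ∑ j ∈ Finset.range n, ENNReal.ofReal (orderedEigenvalue T (d + 1 + j)) ^ 2 =
        ENNReal.ofReal (∑ j ∈ Finset.range m, orderedEigenvalue T (d + 1 + j) ^ 2) := by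
  induction n with
  | zero => exact ⟨0, by simpa using hd, by simp⟩
  | succ n ih =>
    rcases lt_or_ge 0 (orderedEigenvalue T (d + 1 + n)) with h | h
    · have h1 : ∀ i < d + (n + 1), 0 < orderedEigenvalue T (i + 1) := fun i hi ↦
        h.trans_le (orderedEigenvalue_le_of_le i.succ_ne_zero (by omega) h)
      refine ⟨n + 1, h1, ?_⟩
      rw [ENNReal.ofReal_sum_of_nonneg fun _ _ ↦ sq_nonneg _]
      refine Finset.sum_congr rfl fun j hj ↦ (ENNReal.ofReal_pow ?_ 2).symm
      have h2 := h1 (d + j) (by have := Finset.mem_range.1 hj; omega)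
      rw [add_right_comm] at h2
      exact h2.le
    · obtain ⟨m, hm1, hm2⟩ := ih
      refine ⟨m, hm1, ?_⟩
      rw [Finset.sum_range_succ, ENNReal.ofReal_of_nonpos h, hm2]
      simp

lemma exists_prefix_near_tail (T : H →L[ℝ] H) {d : ℕ}
    (hd : ∀ i < d, 0 < orderedEigenvalue T (i + 1)) {Λ : ℝ} (hΛ : 0 < Λ)
    (h : eigenvalueTail T (d + 1) = ENNReal.ofReal Λ) :
    ∃ m, (∀ i < d + m, 0 < orderedEigenvalue T (i + 1)) ∧
      9 / 10 * Λ ^ 2 ≤ ∑ j ∈ Finset.range m, orderedEigenvalue T (d + 1 + j) ^ 2 := by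
  have h1 := eigenvalueTail_sq T (d + 1)
  rw [h, ← ENNReal.ofReal_pow hΛ.le, ENNReal.tsum_eq_iSup_nat] at h1
  have h2 : ENNReal.ofReal (9 / 10 * Λ ^ 2) < ENNReal.ofReal (Λ ^ 2) :=
    (ENNReal.ofReal_lt_ofReal_iff (by positivity)).2 (by nlinarith [sq_pos_of_pos hΛ])
  rw [h1, lt_iSup_iff] at h2
  obtain ⟨n, hn⟩ := h2
  obtain ⟨m, hm1, hm2⟩ := exists_positive_prefix T hd n
  rw [hm2] at hn
  exact ⟨m, hm1, (ENNReal.ofReal_le_ofReal_iff (Finset.sum_nonneg fun _ _ ↦ sq_nonneg _)).1 hn.le⟩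

end Tails

/-! ### Bounds in terms of the ordered eigenvalues. -/

section Bounds

open scoped InnerProductSpace

variable {Ω : Type*} [MeasurableSpace Ω] {P : Measure Ω} [IsProbabilityMeasure P]
  {H : Type*} [NormedAddCommGroup H] [InnerProductSpace ℝ H] [CompleteSpace H]
  [SecondCountableTopology H] [MeasurableSpace H] [BorelSpace H] {ξ : Ω → H}

omit [IsProbabilityMeasure P] in
-- Use `λ_j² ≤ λ_1 λ_j ≤ 2 λ_1 μ_j` and the trace bound; the 2 comes from `q = 1/2`.
lemma eigenvalueTail_one_ne_top (hξ : HasGaussianLaw ξ P) (h0 : ∫ ω, ξ ω ∂P = 0) :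
    eigenvalueTail (covarianceOperator (P.map ξ)) 1 ≠ ⊤ := by
  set T := covarianceOperator (P.map ξ) with hTdef
  have h1 : eigenvalueTail T 1 ^ 2 ≤
      ENNReal.ofReal (orderedEigenvalue T 1 * (2 * ∫ ω, ‖ξ ω‖ ^ 2 ∂P)) := by
    rw [eigenvalueTail_sq, ENNReal.tsum_eq_iSup_nat]
    refine iSup_le fun n ↦ ?_
    obtain ⟨m, hm1, hm2⟩ := exists_positive_prefix T (d := 0) (by simp) n
    simp only [zero_add] at hm1 hm2
    rw [hm2]
    refine ENNReal.ofReal_le_ofReal ?_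
    obtain ⟨v, μ, hv, hle, hμ⟩ := exists_orthonormal_eigenvectors_near
      (covarianceOperator_symm (P.map ξ)) hm1 (q := 1 / 2) (by norm_num)
    have h2 := sum_eigenvalues_le hξ h0 hv hμ
    rcases Nat.eq_zero_or_pos m with rfl | hm
    · have : 0 ≤ orderedEigenvalue T 1 :=
        orderedEigenvalue_nonneg (fun x ↦ isPositive_covarianceOperator.re_inner_nonneg_left x) 1
      have : 0 ≤ ∫ ω, ‖ξ ω‖ ^ 2 ∂P := integral_nonneg fun _ ↦ sq_nonneg _
      simp only [Finset.range_zero, Finset.sum_empty]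
      positivity
    rw [Finset.sum_range]
    have h3 : ∀ i : Fin m, orderedEigenvalue T (1 + i) ^ 2 ≤
        orderedEigenvalue T 1 * (2 * μ i) := fun i ↦ by
      have h4 := hle i
      have h5 := hm1 i i.2
      have h6 := orderedEigenvalue_le_of_le one_ne_zero (by omega) h5
      rw [add_comm 1, sq]
      exact mul_le_mul h6 (by linarith) h5.le (h5.le.trans h6)
    refine (Finset.sum_le_sum fun i _ ↦ h3 i).trans ?_
    rw [← Finset.mul_sum, ← Finset.mul_sum]
    have := hm1 0 hm
    simp only [zero_add] at this
    gcongr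
  intro h
  rw [h] at h1
  simp at h1

lemma le_mul_rpow_mul_of_pos {p : ℝ≥0∞} {C y r ε : ℝ} (hC : 0 < C) (hy : 0 ≤ y) (hr : r < 0)
    (hε : 0 < ε) (h : 0 < y → p ≤ ENNReal.ofReal (ε * (C * y ^ r))) :
    p ≤ ENNReal.ofReal C * ENNReal.ofReal y ^ r * ENNReal.ofReal ε := by
  rcases hy.eq_or_lt with rfl | hy
  · rw [ENNReal.ofReal_zero, ENNReal.zero_rpow_of_neg hr, ENNReal.mul_top (by simpa using hC),
      ENNReal.top_mul (by simpa using hε)]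
    exact le_top
  · refine (h hy).trans_eq ?_
    rw [ENNReal.ofReal_rpow_of_pos hy, ← ENNReal.ofReal_mul hC.le,
      ← ENNReal.ofReal_mul (by positivity), mul_comm]

lemma rpow_neg_half_le_two_mul {x y : ℝ} (hy : 0 < y) (h : y / 4 ≤ x) :
    x ^ (-(1 / 2) : ℝ) ≤ 2 * y ^ (-(1 / 2) : ℝ) := by
  refine (Real.rpow_le_rpow_of_nonpos (by positivity) h (by norm_num)).trans_eq ?_
  rw [Real.div_rpow hy.le (by norm_num), show (4 : ℝ) = 2 ^ (2 : ℝ) by norm_num,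
    ← Real.rpow_mul (by norm_num)]
  norm_num
  ring

/-- An absolute constant for the concentration bound. -/
noncomputable def concentrationConst : ℝ :=
  2 * (1 + (∫ s, charFunMajorant s) + ∫ s, singularMajorant s)

lemma integral_charFunMajorant_nonneg : 0 ≤ ∫ s, charFunMajorant s :=
  integral_nonneg charFunMajorant_nonneg

lemma integral_singularMajorant_nonneg : 0 ≤ ∫ s, singularMajorant s :=
  integral_nonneg singularMajorant_nonneg

lemma concentrationConst_pos : 0 < concentrationConst := by
  have h1 := integral_charFunMajorant_nonneg
  have h2 := integral_singularMajorant_nonneg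
  unfold concentrationConst
  positivity

lemma measure_norm_sq_le_inv_tail (hξ : HasGaussianLaw ξ P) (h0 : ∫ ω, ξ ω ∂P = 0) {Λ : ℝ}
    (hΛ : 0 < Λ) (htail : eigenvalueTail (covarianceOperator (P.map ξ)) 1 = ENNReal.ofReal Λ)
    (hdom : 3 * orderedEigenvalue (covarianceOperator (P.map ξ)) 1 ^ 2 ≤ Λ ^ 2) (a : H) (x : ℝ)
    {ε : ℝ} (hε : 0 < ε) :
    P {ω | x < ‖ξ ω - a‖ ^ 2 ∧ ‖ξ ω - a‖ ^ 2 < x + ε} ≤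
      ENNReal.ofReal (ε * (concentrationConst * Λ ^ (-1 : ℝ))) := by
  set T := covarianceOperator (P.map ξ) with hTdef
  obtain ⟨m, hm1, hm2⟩ := exists_prefix_near_tail T (d := 0) (by simp) hΛ htail
  simp only [zero_add] at hm1 hm2
  obtain ⟨v, μ, hv, hle, hμ⟩ := exists_orthonormal_eigenvectors_near
    (covarianceOperator_symm (P.map ξ)) hm1 (q := 99 / 100) (by norm_num)
  have hpos : ∀ i, 0 < μ i := fun i ↦
    (mul_pos (by norm_num) (hm1 i i.2)).trans_le (hle i)
  -- Indeed `(99/100)² · 9/10 > 5/6`, and `2/5 · 5/6 = 1/3` turns `hdom` into the condition with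
  -- `2/5`.
  have hL : 5 / 6 * Λ ^ 2 ≤ ∑ i, μ i ^ 2 := by
    have h1 : ∑ i : Fin m, (99 / 100) ^ 2 * orderedEigenvalue T (1 + i) ^ 2 ≤ ∑ i, μ i ^ 2 := by
      refine Finset.sum_le_sum fun i _ ↦ ?_
      rw [← mul_pow, add_comm 1]
      exact pow_le_pow_left₀ (mul_pos (by norm_num) (hm1 i i.2)).le (hle i) 2
    rw [← Finset.mul_sum, ← Finset.sum_range (fun i ↦ orderedEigenvalue T (1 + i) ^ 2)] at h1
    nlinarith [sq_nonneg Λ]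
  have hΛ2 := sq_pos_of_pos hΛ
  refine (measure_norm_sq_le_of_no_dominating hξ h0 hv hμ hpos (by linarith) (fun i ↦ ?_) a x
    hε).trans (ENNReal.ofReal_le_ofReal ?_)
  · have h1 := pow_le_pow_left₀ (hpos i).le (eigenvalue_le_orderedEigenvalue_one hv hμ i) 2
    linarith
  · refine mul_le_mul_of_nonneg_left ?_ hε.le
    have h1 : Λ / 2 ≤ √(∑ i, μ i ^ 2) := Real.le_sqrt_of_sq_le (by nlinarith)
    have h2 : (√(∑ i, μ i ^ 2))⁻¹ ≤ 2 * Λ⁻¹ := by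
      refine (inv_anti₀ (by positivity) h1).trans_eq ?_
      field_simp
    have h3 := integral_charFunMajorant_nonneg
    have h4 := integral_singularMajorant_nonneg
    have h5 : 0 < Λ⁻¹ := by positivity
    rw [Real.rpow_neg_one, concentrationConst]
    nlinarith [mul_le_mul_of_nonneg_right h2 h3, mul_nonneg h4 h5.le]

lemma measure_norm_sq_le_mul_tail (hξ : HasGaussianLaw ξ P) (h0 : ∫ ω, ξ ω ∂P = 0) {Λ : ℝ}
    (hΛ : 0 < Λ) (hpos₁ : 0 < orderedEigenvalue (covarianceOperator (P.map ξ)) 1)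
    (htail : eigenvalueTail (covarianceOperator (P.map ξ)) 2 = ENNReal.ofReal Λ)
    (hnonneg : 0 ≤ orderedEigenvalue (covarianceOperator (P.map ξ)) 2)
    (hdom : 3 * orderedEigenvalue (covarianceOperator (P.map ξ)) 2 ^ 2 ≤ Λ ^ 2) (a : H) (x : ℝ)
    {ε : ℝ} (hε : 0 < ε) :
    P {ω | x < ‖ξ ω - a‖ ^ 2 ∧ ‖ξ ω - a‖ ^ 2 < x + ε} ≤
      ENNReal.ofReal (ε * (concentrationConst *
        (orderedEigenvalue (covarianceOperator (P.map ξ)) 1 * Λ) ^ (-(1 / 2) : ℝ))) := by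
  set T := covarianceOperator (P.map ξ) with hTdef
  obtain ⟨n, hm1, hm2⟩ := exists_prefix_near_tail T (d := 1)
    (fun i hi ↦ by obtain rfl : i = 0 := by omega
                   simpa using hpos₁) hΛ htail
  rw [add_comm 1 n] at hm1
  norm_num at hm2
  obtain ⟨v, μ, hv, hle, hμ⟩ := exists_orthonormal_eigenvectors_near
    (covarianceOperator_symm (P.map ξ)) hm1 (q := 99 / 100) (by norm_num)
  have hpos : ∀ i, 0 < μ i := fun i ↦
    (mul_pos (by norm_num) (hm1 i i.2)).trans_le (hle i)
  have hle0 : 99 / 100 * orderedEigenvalue T 1 ≤ μ 0 := by simpa using hle 0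
  have hL : (99 / 100) ^ 2 * (9 / 10 * Λ ^ 2) ≤ ∑ i : Fin n, μ i.succ ^ 2 := by
    have h1 : ∑ i : Fin n, (99 / 100) ^ 2 * orderedEigenvalue T (2 + i) ^ 2 ≤
        ∑ i : Fin n, μ i.succ ^ 2 := by
      refine Finset.sum_le_sum fun i _ ↦ ?_
      have h2 := hle i.succ
      have h3 := hm1 i.succ i.succ.2
      simp only [Fin.val_succ] at h2 h3
      rw [← mul_pow, show 2 + (i : ℕ) = i + 1 + 1 by ring]
      exact pow_le_pow_left₀ (mul_pos (by norm_num) h3).le h2 2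
    rw [← Finset.mul_sum, ← Finset.sum_range (fun i ↦ orderedEigenvalue T (2 + i) ^ 2)] at h1
    exact le_trans (by gcongr) h1
  have hΛ2 := sq_pos_of_pos hΛ
  -- The `μ` are unsorted, so `μ 0` may be the smaller one; then `λ_2 ≥ μ 0 ≥ (99/100) λ_1 ≥
  -- (99/100) μ i.succ`.
  have hle2 : ∀ i : Fin n, 99 / 100 * μ i.succ ≤ orderedEigenvalue T 2 := fun i ↦ by
    rcases min_le_iff.1 (min_eigenvalue_le_orderedEigenvalue_two hv hμ (Fin.succ_ne_zero i))
      with h | h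
    · linarith [hpos i.succ]
    · linarith [eigenvalue_le_orderedEigenvalue_one hv hμ i.succ]
  refine (measure_norm_sq_le_of_one_dominating hξ h0 hv hμ hpos (by linarith) (fun i ↦ ?_) a x
    hε).trans (ENNReal.ofReal_le_ofReal ?_)
  · have h1 := pow_le_pow_left₀ (mul_pos (by norm_num) (hpos i.succ)).le (hle2 i) 2
    linarith
  · refine mul_le_mul_of_nonneg_left ?_ hε.le
    have h1 : Λ / 2 ≤ √(∑ i : Fin n, μ i.succ ^ 2) := Real.le_sqrt_of_sq_le (by nlinarith)
    have h2 : (μ 0 * √(∑ i : Fin n, μ i.succ ^ 2)) ^ (-(1 / 2) : ℝ) ≤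
        2 * (orderedEigenvalue T 1 * Λ) ^ (-(1 / 2) : ℝ) := by
      refine rpow_neg_half_le_two_mul (by positivity) ?_
      have h3 : orderedEigenvalue T 1 / 2 ≤ μ 0 := by linarith
      calc orderedEigenvalue T 1 * Λ / 4 = orderedEigenvalue T 1 / 2 * (Λ / 2) := by ring
        _ ≤ _ := mul_le_mul h3 h1 (by positivity) (hpos 0).le
    have h3 := integral_charFunMajorant_nonneg
    have h4 := integral_singularMajorant_nonneg
    have h5 : 0 < (orderedEigenvalue T 1 * Λ) ^ (-(1 / 2) : ℝ) := by positivity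
    rw [concentrationConst]
    nlinarith [mul_le_mul_of_nonneg_right h2 h4, mul_nonneg h3 h5.le]

lemma measure_norm_sq_le_mul_eigenvalues (hξ : HasGaussianLaw ξ P) (h0 : ∫ ω, ξ ω ∂P = 0)
    (hpos₁ : 0 < orderedEigenvalue (covarianceOperator (P.map ξ)) 1)
    (hpos₂ : 0 < orderedEigenvalue (covarianceOperator (P.map ξ)) 2) (a : H) (x : ℝ)
    {ε : ℝ} (hε : 0 < ε) :
    P {ω | x < ‖ξ ω - a‖ ^ 2 ∧ ‖ξ ω - a‖ ^ 2 < x + ε} ≤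
      ENNReal.ofReal (ε * (concentrationConst *
        (orderedEigenvalue (covarianceOperator (P.map ξ)) 1 *
          orderedEigenvalue (covarianceOperator (P.map ξ)) 2) ^ (-(1 / 2) : ℝ))) := by
  set T := covarianceOperator (P.map ξ) with hTdef
  have hm1 : ∀ i < 2, 0 < orderedEigenvalue T (i + 1) := fun i hi ↦ by
    interval_cases i
    · exact hpos₁
    · exact hpos₂
  obtain ⟨v, μ, hv, hle, hμ⟩ := exists_orthonormal_eigenvectors_near
    (covarianceOperator_symm (P.map ξ)) hm1 (q := 1 / 2) (by norm_num)
  have hpos : ∀ i, 0 < μ i := fun i ↦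
    (mul_pos (by norm_num) (hm1 i i.2)).trans_le (hle i)
  have hle0 : 1 / 2 * orderedEigenvalue T 1 ≤ μ 0 := by simpa using hle 0
  have hle1 : 1 / 2 * orderedEigenvalue T 2 ≤ μ 1 := by simpa using hle 1
  refine (measure_norm_sq_le_of_two_dominating hξ h0 hv hμ hpos a x hε).trans
    (ENNReal.ofReal_le_ofReal ?_)
  refine mul_le_mul_of_nonneg_left ?_ hε.le
  have h2 : (μ 0 * μ 1) ^ (-(1 / 2) : ℝ) ≤
      2 * (orderedEigenvalue T 1 * orderedEigenvalue T 2) ^ (-(1 / 2) : ℝ) := by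
    refine rpow_neg_half_le_two_mul (by positivity) ?_
    calc orderedEigenvalue T 1 * orderedEigenvalue T 2 / 4
        = 1 / 2 * orderedEigenvalue T 1 * (1 / 2 * orderedEigenvalue T 2) := by ring
      _ ≤ _ := mul_le_mul hle0 hle1 (by positivity) (hpos 0).le
  refine h2.trans (mul_le_mul_of_nonneg_right ?_ (by positivity))
  have h3 := integral_charFunMajorant_nonneg
  have h4 := integral_singularMajorant_nonneg
  rw [concentrationConst]
  linarith

lemma measure_norm_sq_le_varkappa (hξ : HasGaussianLaw ξ P) (h0 : ∫ ω, ξ ω ∂P = 0) (a : H)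
    (x : ℝ) {ε : ℝ} (hε : 0 < ε) :
    P {ω | x < ‖ξ ω - a‖ ^ 2 ∧ ‖ξ ω - a‖ ^ 2 < x + ε} ≤
      ENNReal.ofReal concentrationConst * varkappa (covarianceOperator (P.map ξ)) *
        ENNReal.ofReal ε := by
  set T := covarianceOperator (P.map ξ) with hTdef
  have hnn : ∀ k, 0 ≤ orderedEigenvalue T k :=
    orderedEigenvalue_nonneg fun x ↦ isPositive_covarianceOperator.re_inner_nonneg_left x
  have htop₁ := eigenvalueTail_one_ne_top hξ h0
  have htop₂ := ne_top_of_le_ne_top htop₁ (eigenvalueTail_two_le_one T)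
  have htail₁ := (ENNReal.ofReal_toReal htop₁).symm
  have htail₂ := (ENNReal.ofReal_toReal htop₂).symm
  have hreal : ∀ {l Λ : ℝ}, 0 ≤ l → 0 ≤ Λ →
      (3 * ENNReal.ofReal l ^ 2 ≤ ENNReal.ofReal Λ ^ 2 ↔ 3 * l ^ 2 ≤ Λ ^ 2) := by
    intro l Λ hl hΛ
    rw [← ENNReal.ofReal_pow hl, ← ENNReal.ofReal_pow hΛ, ← ENNReal.ofReal_ofNat 3,
      ← ENNReal.ofReal_mul (by norm_num), ENNReal.ofReal_le_ofReal_iff (by positivity)]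
  have hC := concentrationConst_pos
  -- If `λ_1 = 0` the first test holds trivially.
  have hpos₁ : ¬ 3 * ENNReal.ofReal (orderedEigenvalue T 1) ^ 2 ≤ eigenvalueTail T 1 ^ 2 →
      0 < orderedEigenvalue T 1 := fun h ↦ by
    refine (hnn 1).lt_of_ne' fun h1 ↦ h ?_
    simp [h1]
  unfold varkappa
  split_ifs with h1 h2
  · rw [htail₁, ← ENNReal.rpow_neg_one]
    refine le_mul_rpow_mul_of_pos hC ENNReal.toReal_nonneg (by norm_num) hε fun hΛ ↦ ?_
    rw [htail₁, hreal (hnn 1) ENNReal.toReal_nonneg] at h1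
    exact measure_norm_sq_le_inv_tail hξ h0 hΛ htail₁ h1 a x hε
  · rw [htail₂, ← ENNReal.ofReal_mul (hnn 1)]
    refine le_mul_rpow_mul_of_pos hC (mul_nonneg (hnn 1) ENNReal.toReal_nonneg) (by norm_num) hε
      fun hΛ ↦ ?_
    rw [htail₂, hreal (hnn 2) ENNReal.toReal_nonneg] at h2
    exact measure_norm_sq_le_mul_tail hξ h0 (pos_of_mul_pos_right hΛ (hnn 1)) (hpos₁ h1) htail₂
      (hnn 2) h2 a x hε
  · rw [← ENNReal.ofReal_mul (hnn 1)]
    refine le_mul_rpow_mul_of_pos hC (mul_nonneg (hnn 1) (hnn 2)) (by norm_num) hε fun hΛ ↦ ?_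
    exact measure_norm_sq_le_mul_eigenvalues hξ h0 (hpos₁ h1) (pos_of_mul_pos_right hΛ (hnn 1))
      a x hε

end Bounds

theorem mainTheorem3 :
    ∃ C : ℝ≥0, ∀ (Ω : Type*) [MeasurableSpace Ω] (P : Measure Ω) [IsProbabilityMeasure P]
      (H : Type*) [NormedAddCommGroup H] [InnerProductSpace ℝ H] [CompleteSpace H]
      [TopologicalSpace.SeparableSpace H] [MeasurableSpace H] [BorelSpace H]
      (ξ : Ω → H), HasGaussianLaw ξ P → ∫ ω, ξ ω ∂P = 0 →
      ∀ (a : H) (ε : ℝ), 0 < ε →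
        (⨆ (x : ℝ) (_ : 0 < x), P {ω | x < ‖ξ ω - a‖ ^ 2 ∧ ‖ξ ω - a‖ ^ 2 < x + ε}) ≤
            C * varkappa (covarianceOperator (P.map ξ)) * ENNReal.ofReal ε ∧
        (⨆ (x : ℝ) (_ : 0 < x), P {ω | x < ‖ξ ω - a‖ ^ 2 ∧ ‖ξ ω - a‖ ^ 2 < x + ε}) ≤
            C * (eigenvalueTail (covarianceOperator (P.map ξ)) 1 *
              eigenvalueTail (covarianceOperator (P.map ξ)) 2) ^ (-(1 / 2) : ℝ) *
              ENNReal.ofReal ε := by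
  -- The factor 2 is that of `varkappa_le`; only the second bound needs it.
  refine ⟨concentrationConst.toNNReal * 2, ?_⟩
  intro Ω _ P _ H _ _ _ _ _ _ ξ hξ h0 a ε hε
  have : SecondCountableTopology H := UniformSpace.secondCountable_of_separable H
  have h1 : (⨆ (x : ℝ) (_ : 0 < x), P {ω | x < ‖ξ ω - a‖ ^ 2 ∧ ‖ξ ω - a‖ ^ 2 < x + ε}) ≤
      ENNReal.ofReal concentrationConst * varkappa (covarianceOperator (P.map ξ)) *
        ENNReal.ofReal ε :=
    iSup₂_le fun x _ ↦ measure_norm_sq_le_varkappa hξ h0 a x hε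
  have hC : ((concentrationConst.toNNReal * 2 : ℝ≥0) : ℝ≥0∞) =
      ENNReal.ofReal concentrationConst * 2 := by
    rw [ENNReal.coe_mul]
    rfl
  rw [hC]
  refine ⟨h1.trans ?_, h1.trans ?_⟩
  · gcongr
    exact le_mul_of_one_le_right zero_le (by norm_num)
  · rw [mul_assoc _ 2]
    gcongr
    exact varkappa_le _
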